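/- Conventions. A \emph{tract} is a commutative group with zero $T$ (so $T^\times=T\setminus\{0\}$) together with an ideal $N_T$ of the group semiring $\mathbb N[T^\times]$ such that for every $a\in T$ there is a unique $b\in T$, denoted $-a$, with $a+b\in N_T$; here $0\in T$ is identified with the zero of $\mathbb N[T^\times]$. Let $E$ be a finite set with $n$ elements. A (weak) \emph{Grassmann--Plücker function} of rank $r$ on $E$ is a map $\varphi:E^r\to T$ such that the collection of sets $\{e_1,\dots,e_r\}$ with $\varphi(e_1,\dots,e_r)\ne0$ is nonempty and satisfies the basis exchange axiom (so it is the set of bases of a matroid $M_\varphi$, the underlying matroid), such that $\varphi$ is alternating (permuting the arguments by $\sigma$ multiplies by $\operatorname{sign}(\sigma)$, and $\varphi$ vanishes on tuples with repeated entries), and such that the $3$-term Plücker relations $$\varphi(\mathbf e,a,b)\varphi(\mathbf e,c,d)-\varphi(\mathbf e,a,c)\varphi(\mathbf e,b,d)+\varphi(\mathbf e,a,d)\varphi(\mathbf e,b,c)\in N_T$$ hold for all $\mathbf e\in E^{r-2}$ and $a,b,c,d\in E$. A (weak) \emph{$T$-matroid} is a class $[\varphi]$ of such functions modulo multiplication by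 $T^\times$. Its \emph{vectors} are the $X\in T^E$ with $\sum_{e}X(e)\varphi(i_1,\dots,i_{r-1},e)\in N_T$ for all $i_1,\dots,i_{r-1}\in E$ (all of $T^E$ if $r=0$). Its \emph{covectors} are the vectors of the dual $[\varphi^*]$, where $\varphi^*:E^{n-r}\to T$ is $\varphi^*(d_1,\dots,d_{n-r})=\operatorname{sign}(d_1,\dots,d_{n-r},e_1,\dots,e_r)\,\varphi(e_1,\dots,e_r)$ whenever $E=\{d_1,\dots,d_{n-r},e_1,\dots,e_r\}$ (the sign taken with respect to a fixed total order of $E$), and $\varphi^*=0$ on tuples with repeated entries. The tract $T$ is \emph{perfect} if $\sum_e X(e)Y(e)\in N_T$ for every vector $X$ and every covector $Y$ of every $T$-matroid. For a matroid $M$ on $E$, a \emph{hyperplane function} for a hyperplane (corank $1$ flat) $H$ is a function $E\to T$ with support $E\setminus H$. A \emph{$T$-representation} of $M$ is a family of hyperplane functions $\eta_H$, one for each hyperplane $H$, such that for all pairwise distinct hyperplanes $H_1,H_2,H_3$ for which $H_1\cap H_2\cap H_3$ is a flat of corank $2$ there are $c_1,c_2,c_3\in T$, not all zero, with $\sum_i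 c_i\eta_{H_i}(e)\in N_T$ for all $e\in E$. It is a $T$-representation \emph{for} $[\varphi]$ if $M_\varphi=M$ and $\eta_H(d)/\eta_H(e)=\varphi(i_1,\dots,i_{r-1},d)/\varphi(i_1,\dots,i_{r-1},e)$ for all hyperplanes $H$, all $i_1,\dots,i_{r-1}$ with closure $H$ and all $d,e\in E\setminus H$. The $T$-matroid $[\varphi]$ is a \emph{quotient} of the $T$-matroid $[\psi]$ on $E$ if all $\eta_H$, for a $T$-representation $\eta$ for $[\varphi]$, are covectors of $[\psi]$. For a flat $F$ of $M_\varphi$ of corank $s$, the \emph{$F$-quotient} $[\varphi_F]$ is the $T$-matroid of rank $s$ given by $\varphi_F(e_1,\dots,e_s)=\varphi(i_1,\dots,i_{r-s},e_1,\dots,e_s)$ for $i_1,\dots,i_{r-s}\in F$ that span $F$; its class does not depend on the choice of the $i_j$. Theorem. Let $T$ be a perfect tract, $M$ a matroid on the finite set $E$, and $\Lambda^{\le2}$ the set of flats of $M$ of corank $1$ or $2$. A \emph{$(\Lambda^{\le2},T)$-representation} of $M$ is a family of Grassmann--Plücker functions $\psi_F:E^{\operatorname{cork}F}\to T$, $F\in\Lambda^{\le2}$,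 such that $\psi_H$ is a hyperplane function for $H$ for every hyperplane $H$, and $[\psi_H]$ is a quotient of $[\psi_F]$ whenever $H$ is a hyperplane, $F\in\Lambda^{\le2}$ and $F\subseteq H$. For every $(\Lambda^{\le2},T)$-representation $\psi$ of $M$ there is a unique $T$-matroid $[\varphi]$ with underlying matroid $M$ such that $[\psi_F]=[\varphi_F]$ for every $F\in\Lambda^{\le2}$. Conversely, for every $T$-matroid $[\varphi]$ with underlying matroid $M$ there is a $(\Lambda^{\le2},T)$-representation $\psi$ of $M$ with $[\psi_F]=[\varphi_F]$ for every $F\in\Lambda^{\le2}$, and $\psi$ is uniquely determined by $[\varphi]$ up to multiplying each function $\psi_F$ by a scalar $a_F\in T^\times$. -/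

import Mathlib

open Set

noncomputable section

namespace TractMatroid

universe u v

/-! ### Tracts -/

section Tracts

/-- The embedding of a pointed group `T` into its ambient semiring `ℕ[Tˣ]`: zero goes to zero, and
a nonzero element `a` goes to the formal sum `1 • a`. -/
def toAmbient {T : Type u} [CommGroupWithZero T] (a : T) : MonoidAlgebra ℕ Tˣ := by
  classical
  exact if h : a = 0 then 0 else MonoidAlgebra.single (Units.mk0 a h) 1

/-- An (ideal) tract: a pointed group (a commutative group with zero) together with an ideal of its
ambient semiring `ℕ[Tˣ]`, the nullset, such that every `a` has a unique additive inverse `b`, that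
is, a unique `b` such that the formal sum `a + b` is in the nullset. -/
class Tract (T : Type u) extends CommGroupWithZero T where
  /-- The nullset. -/
  nullset : Ideal (MonoidAlgebra ℕ Tˣ)
  existsUnique_neg : ∀ a : T, ∃! b : T, toAmbient a + toAmbient b ∈ nullset

variable {T : Type u} [Tract T]

/-- The additive inverse in a tract. -/
def tneg (a : T) : T := (Tract.existsUnique_neg a).choose

/-- The formal sum `∑ i, a i` lies in the nullset of the tract. -/
def NullSum {ι : Type*} [Fintype ι] (a : ι → T) : Prop :=
  ∑ i, toAmbient (a i) ∈ Tract.nullset (T := T)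

/-- A sign as an element of a tract. -/
def sgn (T : Type u) [Tract T] (s : ℤˣ) : T := if s = 1 then 1 else tneg 1

theorem toAmbient_zero : toAmbient (0 : T) = 0 := by simp [toAmbient]

theorem toAmbient_unit_mul (a : Tˣ) (b : T) :
    toAmbient ((a : T) * b) = MonoidAlgebra.single a 1 * toAmbient b := by
  unfold toAmbient
  by_cases hb : b = 0
  · simp [hb]
  · have hab : (a : T) * b ≠ 0 := mul_ne_zero a.ne_zero hb
    rw [dif_neg hab, dif_neg hb, MonoidAlgebra.single_mul_single]
    congr 1
    ext
    simp

theorem tneg_one_ne_zero : tneg (1 : T) ≠ 0 := by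
  intro h
  have h1 := (Tract.existsUnique_neg (1 : T)).choose_spec.1
  rw [show (Tract.existsUnique_neg (1 : T)).choose = 0 from h, toAmbient_zero, add_zero] at h1
  have h2 := (Tract.existsUnique_neg (0 : T)).unique (y₁ := 0) (y₂ := 1)
    (by simp [toAmbient_zero]) (by simpa [toAmbient_zero] using h1)
  exact zero_ne_one h2

theorem sgn_ne_zero (s : ℤˣ) : sgn T s ≠ 0 := by
  unfold sgn
  split_ifs
  · exact one_ne_zero
  · exact tneg_one_ne_zero

theorem NullSum.unit_mul {ι : Type*} [Fintype ι] {f : ι → T} (a : Tˣ) (h : NullSum f) :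
    NullSum fun i => (a : T) * f i := by
  unfold NullSum at *
  simp_rw [toAmbient_unit_mul, ← Finset.mul_sum]
  exact Ideal.mul_mem_left _ _ h

end Tracts

/-! ### Grassmann-Plücker functions -/

/-- The tuple `(x₁, …, x_k, y₁, …, y_s)`, as a tuple of length `r = k + s`. -/
def joinTuple {E : Type v} {k s r : ℕ} (h : k + s = r) (x : Fin k → E) (y : Fin s → E) :
    Fin r → E :=
  Fin.append x y ∘ Fin.cast h.symm

/-- `B` is of the form `{e₁, …, e_r}` with `φ (e₁, …, e_r) ≠ 0`. -/
def IsGPBase {T : Type u} [Tract T] {E : Type v} {r : ℕ} (φ : (Fin r → E) → T) (B : Set E) :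
    Prop :=
  ∃ e : Fin r → E, φ e ≠ 0 ∧ range e = B

/-- A (weak) Grassmann-Plücker function of rank `r` on `E` with coefficients in the tract `T`. -/
structure GPFunction (T : Type u) [Tract T] (E : Type v) (r : ℕ) where
  /-- The underlying function `E ^ r → T`. -/
  toFun : (Fin r → E) → T
  exists_base : ∃ B, IsGPBase toFun B
  exchange : Matroid.ExchangeProperty (IsGPBase toFun)
  alternating : ∀ (e : Fin r → E) (σ : Equiv.Perm (Fin r)),
    toFun (e ∘ σ) = sgn T (Equiv.Perm.sign σ) * toFun e
  eq_zero : ∀ e : Fin r → E, ¬ Function.Injective e → toFun e = 0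
  pluecker : ∀ (k : ℕ) (h : k + 2 = r) (e : Fin k → E) (a b c d : E),
    NullSum ![toFun (joinTuple h e ![a, b]) * toFun (joinTuple h e ![c, d]),
      tneg (toFun (joinTuple h e ![a, c]) * toFun (joinTuple h e ![b, d])),
      toFun (joinTuple h e ![a, d]) * toFun (joinTuple h e ![b, c])]

instance {T : Type u} [Tract T] {E : Type v} {r : ℕ} :
    CoeFun (GPFunction T E r) (fun _ => (Fin r → E) → T) :=
  ⟨GPFunction.toFun⟩

/-- Two Grassmann-Plücker functions are equivalent if they differ by a factor in `Tˣ`. -/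
instance gpSetoid (T : Type u) [Tract T] (E : Type v) (r : ℕ) : Setoid (GPFunction T E r) where
  r φ φ' := ∃ a : Tˣ, ∀ e, φ' e = a * φ e
  iseqv :=
    { refl := fun _ => ⟨1, fun _ => by simp⟩
      symm := fun ⟨a, h⟩ => ⟨a⁻¹, fun e => by rw [h e]; simp⟩
      trans := fun ⟨a, h⟩ ⟨b, h'⟩ => ⟨b * a, fun e => by rw [h' e, h e]; simp [mul_assoc]⟩ }

/-- A (weak) `T`-matroid of rank `r` on `E`: the `Tˣ`-class of a Grassmann-Plücker function. -/
def TMatroid (T : Type u) [Tract T] (E : Type v) (r : ℕ) : Type (max u v) :=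
  Quotient (gpSetoid T E r)

namespace GPFunction

variable {T : Type u} [Tract T] {E : Type v} {r : ℕ}

/-- The class `[φ]`. -/
def toTMatroid (φ : GPFunction T E r) : TMatroid T E r := Quotient.mk _ φ

/-- The underlying matroid `M_φ` of a Grassmann-Plücker function. -/
def matroid [Fintype E] (φ : GPFunction T E r) : Matroid E :=
  Matroid.ofIsBaseOfFinite (E := Set.univ) Set.finite_univ (IsGPBase φ) φ.exists_base φ.exchange
    (fun _ _ => Set.subset_univ _)

theorem isGPBase_congr {φ φ' : GPFunction T E r} (h : φ ≈ φ') : IsGPBase φ = IsGPBase φ' := by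
  obtain ⟨a, h⟩ := h
  funext B
  simp [IsGPBase, h]

theorem matroid_congr [Fintype E] {φ φ' : GPFunction T E r} (h : φ ≈ φ') :
    φ.matroid = φ'.matroid := by
  refine Matroid.ext_isBase rfl fun B _ => ?_
  change IsGPBase φ B ↔ IsGPBase φ' B
  rw [isGPBase_congr h]

theorem injective_of_ne_zero (φ : GPFunction T E r) {e : Fin r → E} (h : φ e ≠ 0) :
    Function.Injective e := by
  by_contra hc
  exact h (φ.eq_zero e hc)

theorem rank_le_card [Fintype E] (φ : GPFunction T E r) : r ≤ Fintype.card E := by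
  obtain ⟨_, e, he, -⟩ := φ.exists_base
  simpa using Fintype.card_le_of_injective e (φ.injective_of_ne_zero he)

theorem ne_zero_of_range_eq (φ : GPFunction T E r) {x y : Fin r → E} (hx : φ x ≠ 0)
    (h : range y = range x) : φ y ≠ 0 := by
  classical
  have hinj := φ.injective_of_ne_zero hx
  have hy : ∀ j, ∃ i, x i = y j := fun j => by
    have : y j ∈ range x := h ▸ mem_range_self j
    exact this
  choose σ hσ using hy
  have hsurj : Function.Surjective σ := fun i => by
    have : x i ∈ range y := h ▸ mem_range_self i
    obtain ⟨j, hj⟩ := this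
    exact ⟨j, hinj (by rw [hσ, hj])⟩
  have hbij : Function.Bijective σ := Finite.injective_iff_bijective.mp
    (Finite.injective_iff_surjective.mpr hsurj)
  have hyx : y = x ∘ (Equiv.ofBijective σ hbij) := funext fun j => (hσ j).symm
  rw [hyx, φ.alternating]
  exact mul_ne_zero (sgn_ne_zero _) hx

end GPFunction

/-- The underlying matroid of a `T`-matroid. -/
def TMatroid.matroid {T : Type u} [Tract T] {E : Type v} {r : ℕ} [Fintype E]
    (m : TMatroid T E r) : Matroid E :=
  Quotient.lift GPFunction.matroid (fun _ _ h => GPFunction.matroid_congr h) m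

/-! ### Flats of small corank, `T`-representations -/

/-- The rank of a matroid on a finite set, as a natural number. -/
def rank {E : Type v} (M : Matroid E) : ℕ := M.eRank.toNat

/-- The rank of a set in a matroid on a finite set, as a natural number. -/
def rk {E : Type v} (M : Matroid E) (F : Set E) : ℕ := (M.eRk F).toNat

/-- The corank of a set in a matroid on a finite set. -/
def corank {E : Type v} (M : Matroid E) (F : Set E) : ℕ := rank M - rk M F

/-- The hyperplanes of `M`, i.e. its flats of corank `1`. -/
def Hyperplane {E : Type v} (M : Matroid E) : Type v := {H : Set E // M.IsFlat H ∧ corank M H = 1}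

/-- The flats of `M` of corank `1` or `2`. -/
def SmallCorankFlat {E : Type v} (M : Matroid E) : Type v :=
  {F : Set E // M.IsFlat F ∧ (corank M F = 1 ∨ corank M F = 2)}

/-- `X : E → T` is a hyperplane function for `H`: its support is the complement of `H`. -/
def IsHyperplaneFunction {T : Type u} [Tract T] {E : Type v} (H : Set E) (X : E → T) : Prop :=
  Function.support X = Hᶜ

/-- Linear dependence of a finite family of elements of `T ^ E`. -/
def LinDependent {T : Type u} [Tract T] {E : Type v} {ι : Type*} [Fintype ι] (X : ι → E → T) :
    Prop :=
  ∃ c : ι → T, (∃ i, c i ≠ 0) ∧ ∀ e, NullSum fun i => c i * X i e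

/-- `η` is a `T`-representation of `M`: each `η_H` is a hyperplane function for `H`, and
`η_{H₁}, η_{H₂}, η_{H₃}` are linearly dependent for each modular triple of hyperplanes. -/
structure IsTRepresentation {T : Type u} [Tract T] {E : Type v} (M : Matroid E)
    (η : Hyperplane M → E → T) : Prop where
  hyperplaneFunction : ∀ H, IsHyperplaneFunction H.1 (η H)
  linDependent : ∀ H₁ H₂ H₃ : Hyperplane M, H₁ ≠ H₂ → H₁ ≠ H₃ → H₂ ≠ H₃ →
    M.IsFlat (H₁.1 ∩ H₂.1 ∩ H₃.1) → corank M (H₁.1 ∩ H₂.1 ∩ H₃.1) = 2 →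
    LinDependent ![η H₁, η H₂, η H₃]

/-- The `T`-representation `η` of `M` corresponds to the `T`-matroid `[φ]`: the underlying matroid
of `φ` is `M`, and `η_H(d) / η_H(e) = φ(i₁, …, i_{r-1}, d) / φ(i₁, …, i_{r-1}, e)` for every
hyperplane `H`, all `i₁, …, i_{r-1}` with closure `H` and all `d, e ∉ H`. -/
def Corresponds {T : Type u} [Tract T] {E : Type v} [Fintype E] {r : ℕ} (M : Matroid E)
    (η : Hyperplane M → E → T) (φ : GPFunction T E r) : Prop :=
  φ.matroid = M ∧
    ∀ (H : Hyperplane M) (k : ℕ) (h : k + 1 = r) (i : Fin k → E), M.closure (range i) = H.1 →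
      ∀ d e : E, d ∉ H.1 → e ∉ H.1 →
        η H d / η H e = φ (joinTuple h i ![d]) / φ (joinTuple h i ![e])

/-! ### Vectors, covectors, perfect tracts -/

section Vectors

variable {T : Type u} [Tract T] {E : Type v} [Fintype E]

/-- Orthogonality of two elements of `T ^ E`. -/
def Orthogonal (X Y : E → T) : Prop := NullSum fun e => X e * Y e

/-- The vectors of (the class of) a function `φ : E ^ r → T`: the `X` with
`∑ e, X(e) φ(i₁, …, i_{r-1}, e)` null for all `i₁, …, i_{r-1}`. For `r = 0` there is no condition,
and all of `T ^ E` is obtained. -/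
def vectors {r : ℕ} (φ : (Fin r → E) → T) : Set (E → T) :=
  {X | ∀ (k : ℕ) (h : k + 1 = r) (i : Fin k → E),
    NullSum fun e => X e * φ (joinTuple h i ![e])}

/-- The sign of an ordering `(x₁, …, x_n)` of all elements of `E`, relative to a fixed chosen total
ordering of `E`. -/
def tupleSign (x : Fin (Fintype.card E) → E) (hx : Function.Bijective x) : ℤˣ :=
  Equiv.Perm.sign ((Equiv.ofBijective x hx).trans (Fintype.equivFin E))

/-- The dual function `φ* : E ^ (n - r) → T`, with
`φ*(d₁, …, d_{n-r}) = sign(d₁, …, d_{n-r}, e₁, …, e_r) φ(e₁, …, e_r)` whenever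
`E = {d₁, …, d_{n-r}, e₁, …, e_r}`, and `φ*(d₁, …, d_{n-r}) = 0` if the `d_j` are not distinct. -/
def GPFunction.dual {r : ℕ} (φ : GPFunction T E r) : (Fin (Fintype.card E - r) → E) → T := by
  classical
  exact fun d =>
    if h : ∃ e : Fin r → E,
      Function.Bijective (joinTuple (Nat.sub_add_cancel φ.rank_le_card) d e) then
      sgn T (tupleSign _ h.choose_spec) * φ h.choose
    else 0

/-- The covectors of `[φ]`: the vectors of `[φ*]`. -/
def GPFunction.covectors {r : ℕ} (φ : GPFunction T E r) : Set (E → T) := vectors φ.dual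

/-- If the `d_j` are not distinct, the dual function vanishes. -/
theorem GPFunction.dual_eq_zero {r : ℕ} (φ : GPFunction T E r)
    (d : Fin (Fintype.card E - r) → E) (hd : ¬ Function.Injective d) : φ.dual d = 0 := by
  unfold GPFunction.dual
  refine dif_neg ?_
  rintro ⟨e, he⟩
  apply hd
  have h := he.1.comp (Fin.cast_injective (Nat.sub_add_cancel φ.rank_le_card))
  have h2 : Function.Injective (Fin.append d e) := by
    simpa [joinTuple, Function.comp_def] using h
  exact (Fin.append_injective_iff.mp h2).1

theorem vectors_unit_mul {r : ℕ} {f g : (Fin r → E) → T} (a : Tˣ) (h : ∀ e, g e = a * f e) :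
    vectors f ⊆ vectors g := by
  intro X hX k hk i
  have := (hX k hk i).unit_mul a
  simpa [h, mul_left_comm] using this

theorem GPFunction.covectors_congr {r : ℕ} {φ φ' : GPFunction T E r} (h : φ ≈ φ') :
    φ.covectors ⊆ φ'.covectors := by
  obtain ⟨a, h⟩ := h
  refine vectors_unit_mul a fun e => ?_
  unfold GPFunction.dual
  split_ifs
  · rw [h, mul_left_comm]
  · simp

end Vectors

/-- A tract is perfect if vectors are orthogonal to covectors for all `T`-matroids (on all finite
ground sets, which may be taken to be of the form `{1, …, n}`). -/
def IsPerfect (T : Type u) [Tract T] : Prop :=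
  ∀ (n r : ℕ) (φ : GPFunction T (Fin n) r), ∀ X ∈ vectors φ, ∀ Y ∈ φ.covectors, Orthogonal X Y

/-! ### Matroid quotients -/

section Quotients

variable {T : Type u} [Tract T] {E : Type v} [Fintype E] {r s : ℕ}

/-- `[φ]` is a quotient of `[ψ]`: the hyperplane functions of a `T`-representation for `[φ]` are
covectors of `[ψ]`. -/
def GPFunction.IsQuotient (φ : GPFunction T E r) (ψ : GPFunction T E s) : Prop :=
  ∃ (M : Matroid E) (η : Hyperplane M → E → T),
    IsTRepresentation M η ∧ Corresponds M η φ ∧ ∀ H, η H ∈ ψ.covectors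

theorem GPFunction.IsQuotient.congr {φ φ' : GPFunction T E r} {ψ ψ' : GPFunction T E s}
    (hφ : φ ≈ φ') (hψ : ψ ≈ ψ') (h : φ.IsQuotient ψ) : φ'.IsQuotient ψ' := by
  obtain ⟨M, η, h1, ⟨h2, h3⟩, h4⟩ := h
  refine ⟨M, η, h1, ⟨by rw [← matroid_congr hφ, h2], ?_⟩, fun H => covectors_congr hψ (h4 H)⟩
  obtain ⟨a, ha⟩ := hφ
  intro H k hk i hi d e hd he
  rw [h3 H k hk i hi d e hd he, ha, ha, mul_div_mul_left _ _ a.ne_zero]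

/-- The relation of matroid quotients for `T`-matroids. -/
def TMatroid.IsQuotient (m : TMatroid T E r) (n : TMatroid T E s) : Prop :=
  Quotient.lift₂ GPFunction.IsQuotient
    (fun _ _ _ _ h h' => propext
      ⟨fun hq => hq.congr h h', fun hq => hq.congr (Setoid.symm h) (Setoid.symm h')⟩) m n

end Quotients

/-! ### `F`-quotients -/

section JoinTuple

variable {E : Type v}

theorem range_joinTuple {k s r : ℕ} (h : k + s = r) (x : Fin k → E) (y : Fin s → E) :
    range (joinTuple h x y) = range x ∪ range y := by
  subst h
  ext z
  simp only [joinTuple, mem_range, mem_union, Function.comp_apply, Fin.cast_eq_self]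
  constructor
  · rintro ⟨j, rfl⟩
    refine Fin.addCases (fun j => ?_) (fun j => ?_) j
    · exact Or.inl ⟨j, by simp⟩
    · exact Or.inr ⟨j, by simp⟩
  · rintro (⟨j, rfl⟩ | ⟨j, rfl⟩)
    · exact ⟨Fin.castAdd _ j, by simp⟩
    · exact ⟨Fin.natAdd _ j, by simp⟩

theorem joinTuple_injective {k s r : ℕ} (h : k + s = r) (x : Fin k → E) (y : Fin s → E) :
    Function.Injective (joinTuple h x y) ↔
      Function.Injective x ∧ Function.Injective y ∧ ∀ i j, x i ≠ y j := by
  subst h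
  exact Fin.append_injective_iff

theorem joinTuple_assoc {k l s t r : ℕ} (h : k + t = r) (h' : l + s = t) (x : Fin k → E)
    (y : Fin l → E) (z : Fin s → E) :
    joinTuple h x (joinTuple h' y z) =
      joinTuple (show k + l + s = r by omega) (Fin.append x y) z := by
  subst h'
  subst h
  simp only [joinTuple]
  rw [Fin.append_assoc]
  rfl

theorem joinTuple_comp_perm {k s r : ℕ} (h : k + s = r) (x : Fin k → E) (y : Fin s → E)
    (σ : Equiv.Perm (Fin s)) :
    ∃ τ : Equiv.Perm (Fin r), Equiv.Perm.sign τ = Equiv.Perm.sign σ ∧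
      joinTuple h x (y ∘ σ) = joinTuple h x y ∘ τ := by
  subst h
  refine ⟨finSumFinEquiv.permCongr (Equiv.Perm.sumCongr 1 σ), by simp, ?_⟩
  funext j
  refine Fin.addCases (fun j => ?_) (fun j => ?_) j <;>
    simp [joinTuple, Equiv.permCongr_apply]

end JoinTuple

section FQuotients

variable {E : Type v} [Fintype E]

theorem rk_add_corank (M : Matroid E) (F : Set E) : rk M F + corank M F = rank M := by
  have h : rk M F ≤ rank M := by
    refine ENat.toNat_le_toNat (M.eRk_le_eRank F) ?_
    exact M.eRank_ne_top_iff.mpr inferInstance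
  unfold corank
  omega

theorem exists_spanningTuple (M : Matroid E) {F : Set E} (hF : M.IsFlat F) :
    ∃ i : Fin (rk M F) → E, M.closure (range i) = F ∧ M.Indep (range i) := by
  obtain ⟨I, hI⟩ := M.exists_isBasis F hF.subset_ground
  have hcard : Nat.card I = rk M F := by
    rw [rk, ← hI.encard_eq_eRk]
    rfl
  let f : Fin (rk M F) ≃ I := (Finite.equivFinOfCardEq hcard).symm
  refine ⟨fun j => (f j : E), ?_⟩
  have : range (fun j => (f j : E)) = I := by
    have := f.surjective.range_comp (Subtype.val : I → E)
    simpa [Function.comp_def] using this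
  rw [this, hI.closure_eq_closure, hF.closure]
  exact ⟨rfl, hI.indep⟩

/-- A chosen tuple of `rk F` elements that spans the flat `F` of `M`. -/
def spanningTuple (M : Matroid E) {F : Set E} (hF : M.IsFlat F) : Fin (rk M F) → E :=
  (exists_spanningTuple M hF).choose

theorem closure_spanningTuple (M : Matroid E) {F : Set E} (hF : M.IsFlat F) :
    M.closure (range (spanningTuple M hF)) = F :=
  (exists_spanningTuple M hF).choose_spec.1

theorem indep_spanningTuple (M : Matroid E) {F : Set E} (hF : M.IsFlat F) :
    M.Indep (range (spanningTuple M hF)) :=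
  (exists_spanningTuple M hF).choose_spec.2

variable {T : Type u} [Tract T]

/-- Fixing the first `k` arguments `i₁, …, i_k` of a Grassmann-Plücker function of rank
`r = k + s` yields a Grassmann-Plücker function of rank `s`, provided that `{i₁, …, i_k}` is an
independent set of size `k`, i.e. that the function obtained is not identically zero. -/
def GPFunction.fixArgs {k s r : ℕ} (φ : GPFunction T E r) (h : k + s = r) (i : Fin k → E)
    (hi : ∃ e, φ (joinTuple h i e) ≠ 0) : GPFunction T E s where
  toFun e := φ (joinTuple h i e)
  exists_base := let ⟨e, he⟩ := hi; ⟨range e, e, he, rfl⟩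
  exchange := by
    classical
    rintro _ _ ⟨e₁, h₁, rfl⟩ ⟨e₂, h₂, rfl⟩ a ⟨⟨p, rfl⟩, ha⟩
    have inj₁ := (joinTuple_injective h i e₁).mp (φ.injective_of_ne_zero h₁)
    have hai : e₁ p ∉ range i := by
      rintro ⟨q, hq⟩
      exact inj₁.2.2 q p hq
    obtain ⟨b, ⟨hb₂, hb₁⟩, e', he', hr⟩ := φ.exchange _ _ ⟨_, h₁, rfl⟩ ⟨_, h₂, rfl⟩ (e₁ p)
      (by
        rw [range_joinTuple, range_joinTuple]
        exact ⟨Or.inr ⟨p, rfl⟩, fun hc => hc.elim hai ha⟩)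
    rw [range_joinTuple] at hb₁ hb₂ hr
    rw [mem_union, not_or] at hb₁
    have hb₂ : b ∈ range e₂ := hb₂.resolve_left hb₁.1
    have hrange : range (Function.update e₁ p b) = insert b (range e₁ \ {e₁ p}) := by
      ext z
      simp only [mem_range, mem_insert_iff, mem_sdiff, mem_singleton_iff]
      constructor
      · rintro ⟨q, rfl⟩
        by_cases hq : q = p
        · subst hq
          simp
        · right
          rw [Function.update_of_ne hq]
          exact ⟨⟨q, rfl⟩, fun hc => hq (inj₁.2.1 hc)⟩
      · rintro (rfl | ⟨⟨q, rfl⟩, hq⟩)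
        · exact ⟨p, by simp⟩
        · refine ⟨q, Function.update_of_ne ?_ _ _⟩
          rintro rfl
          exact hq rfl
    refine ⟨b, ⟨hb₂, hb₁.2⟩, Function.update e₁ p b, ?_, hrange⟩
    refine φ.ne_zero_of_range_eq he' ?_
    rw [range_joinTuple, hrange, hr, union_sdiff_distrib, sdiff_singleton_eq_self hai]
    ext z
    simp only [mem_union, mem_insert_iff]
    tauto
  alternating e σ := by
    obtain ⟨τ, hτ, h'⟩ := joinTuple_comp_perm h i e σ
    rw [h', φ.alternating, hτ]
  eq_zero e he := φ.eq_zero _ fun hc => he ((joinTuple_injective h i e).mp hc).2.1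
  pluecker l hl e a b c d := by
    simp only [joinTuple_assoc]
    exact φ.pluecker (k + l) (by omega) (Fin.append i e) a b c d

theorem exists_joinTuple_ne_zero {M : Matroid E} (φ : GPFunction T E (rank M))
    (hφ : φ.matroid = M) {F : Set E} (hF : M.IsFlat F) :
    ∃ e, φ (joinTuple (rk_add_corank M F) (spanningTuple M hF) e) ≠ 0 := by
  obtain ⟨B, hB, hIB⟩ := (indep_spanningTuple M hF).exists_isBase_superset
  have hB' : IsGPBase φ B := by
    rw [← hφ] at hB
    exact hB
  obtain ⟨x, hx, rfl⟩ := hB'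
  have hinj := φ.injective_of_ne_zero hx
  have hI : (range (spanningTuple M hF)).ncard = rk M F := by
    have h := (indep_spanningTuple M hF).eRk_eq_encard
    rw [← M.eRk_closure_eq, closure_spanningTuple] at h
    exact (congrArg ENat.toNat h).symm
  have hcard : Nat.card ↥(range x \ range (spanningTuple M hF)) = corank M F := by
    have h1 := Set.ncard_sdiff_add_ncard_of_subset hIB
    have h2 : (range x).ncard = rank M := by
      rw [← Set.image_univ, Set.ncard_image_of_injective _ hinj]
      simp
    have h3 := rk_add_corank M F
    rw [Nat.card_coe_set_eq]
    omega
  let f := (Finite.equivFinOfCardEq hcard).symm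
  refine ⟨fun j => (f j : E), φ.ne_zero_of_range_eq hx ?_⟩
  have hf : range (fun j => (f j : E)) = range x \ range (spanningTuple M hF) := by
    refine (f.surjective.range_comp (Subtype.val : ↥(range x \ range (spanningTuple M hF)) → E)).trans
      Subtype.range_coe
  rw [range_joinTuple, hf, union_sdiff_cancel hIB]

/-- The `F`-quotient `φ_F : E ^ (corank F) → T` of a Grassmann-Plücker function `φ` with underlying
matroid `M`, given by `φ_F(e₁, …, e_s) = φ(i₁, …, i_{r-s}, e₁, …, e_s)`, where `i₁, …, i_{r-s}`
is a chosen spanning tuple of the flat `F`. Its class does not depend on that choice. -/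
def GPFunction.fQuotient {M : Matroid E} (φ : GPFunction T E (rank M)) (hφ : φ.matroid = M)
    {F : Set E} (hF : M.IsFlat F) : GPFunction T E (corank M F) :=
  φ.fixArgs (rk_add_corank M F) (spanningTuple M hF) (exists_joinTuple_ne_zero φ hφ hF)

theorem TMatroid.matroid_out {r : ℕ} (m : TMatroid T E r) : (Quotient.out m).matroid = m.matroid :=
  congrArg TMatroid.matroid (Quotient.out_eq m)

/-- The `F`-quotient `[φ_F]` of a `T`-matroid `[φ]` with underlying matroid `M`. -/
def TMatroid.fQuotient {M : Matroid E} (m : TMatroid T E (rank M)) (hm : m.matroid = M)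
    {F : Set E} (hF : M.IsFlat F) : TMatroid T E (corank M F) :=
  ((Quotient.out m).fQuotient (m.matroid_out.trans hm) hF).toTMatroid

/-- The class `[φ_F]` does not depend on the representative of `[φ]`. -/
theorem TMatroid.fQuotient_mk {M : Matroid E} (φ : GPFunction T E (rank M)) (hφ : φ.matroid = M)
    {F : Set E} (hF : M.IsFlat F) :
    TMatroid.fQuotient φ.toTMatroid hφ hF = (φ.fQuotient hφ hF).toTMatroid := by
  have h : (Quotient.out φ.toTMatroid) ≈ φ := Quotient.mk_out φ
  obtain ⟨a, h⟩ := h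
  exact Quotient.sound ⟨a, fun e => h _⟩

end FQuotients

/-! ### Representations by quotients of small corank -/

/-- A `(Λ^{≤2}, T)`-representation of `M`: a family of Grassmann-Plücker functions
`ψ_F : E ^ (corank F) → T`, indexed by the flats `F` of corank `1` and `2`, such that `ψ_H` is a
hyperplane function for every hyperplane `H`, and `[ψ_H]` is a quotient of `[ψ_F]` for `F ⊆ H`. -/
structure SmallCorankRep (T : Type u) [Tract T] {E : Type v} [Fintype E] (M : Matroid E) where
  /-- The family of Grassmann-Plücker functions. -/
  ψ : ∀ F : SmallCorankFlat M, GPFunction T E (corank M F.1)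
  hyperplaneFunction : ∀ H : SmallCorankFlat M, corank M H.1 = 1 →
    IsHyperplaneFunction H.1 fun e => ψ H fun _ => e
  isQuotient : ∀ F H : SmallCorankFlat M, corank M H.1 = 1 → F.1 ⊆ H.1 →
    TMatroid.IsQuotient (ψ H).toTMatroid (ψ F).toTMatroid

end TractMatroid

end

open TractMatroid

namespace TractMatroid

universe u v

/-! ### Arithmetic of signs and null sums in a tract. -/

section TractArithmetic

variable {T : Type u} [Tract T]

/-! Write η_H for the hyperplane function given by ψ_H. The Grassmann–Plücker function sought is
reconstructed from the η_H. A lift over a set X (`IsLift`) is an alternating function whose support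
consists of the bases of M/X and whose restrictions to the last variable are multiples of the η_H; φ
will be a lift over ∅. In positive corank two lifts over X differ by a unit (`IsLift.unique`). This
yields the uniqueness of [φ] and also [ψ_F] = [φ_F], because φ_F and ψ_F are both lifts over F.

Existence is a local-to-global argument. In corank 2 the function ψ_F itself is a lift: the covector
relations force ψ_F(a, ·) to be proportional to η_H for the hyperplane H spanned by F and a
(`GPFunction.isLift_of_mem_covectors`). In corank at least 3, lifts φ_a over X ∪ {a} exist by
induction, and φ_a(b, ·) and -φ_b(a, ·) are proportional by uniqueness. The proportionality factors
form a cocycle on a complete multipartite graph, which is a coboundary (`exists_coboundary`); after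
rescaling, the φ_a glue (`exists_isLift`). A 3-term Plücker relation fixes all but two arguments of
each factor, so it takes place in corank 2, where the lift is a multiple of ψ_F
(`IsLift.isPluecker`).

Conversely, a Grassmann–Plücker function is a lift of its own hyperplane functions, since tuples
spanning the same hyperplane give proportional functions (`IsGPOver.exists_unit_mul`). The quotient
condition for H over F of corank 2 is then the 3-term Plücker relation for φ_F
(`GPFunction.joinTuple_mem_covectors`). -/

theorem toAmbient_add_tneg (a : T) :
    toAmbient a + toAmbient (tneg a) ∈ Tract.nullset (T := T) :=
  (Tract.existsUnique_neg a).choose_spec.1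

theorem eq_tneg_of_mem {a b : T} (h : toAmbient a + toAmbient b ∈ Tract.nullset (T := T)) :
    b = tneg a :=
  (Tract.existsUnique_neg a).unique h (toAmbient_add_tneg a)

theorem tneg_zero : tneg (0 : T) = 0 :=
  (eq_tneg_of_mem (by simp [toAmbient_zero])).symm

theorem tneg_tneg (a : T) : tneg (tneg a) = a :=
  (eq_tneg_of_mem (by rw [add_comm]; exact toAmbient_add_tneg a)).symm

theorem toAmbient_mul_mem {ι : Type*} [Fintype ι] {f : ι → T}
    (h : ∑ i, toAmbient (f i) ∈ Tract.nullset (T := T)) (a : T) :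
    ∑ i, toAmbient (a * f i) ∈ Tract.nullset (T := T) := by
  by_cases ha : a = 0
  · simp [ha, toAmbient_zero]
  · exact NullSum.unit_mul (Units.mk0 a ha) h

theorem tneg_eq_mul (a : T) : tneg a = tneg 1 * a := by
  refine (eq_tneg_of_mem ?_).symm
  have := toAmbient_mul_mem (f := ![(1 : T), tneg 1])
    (by simpa using toAmbient_add_tneg (1 : T)) a
  simpa [mul_comm] using this

theorem tneg_one_mul_self : tneg (1 : T) * tneg 1 = 1 := by
  rw [← tneg_eq_mul, tneg_tneg]

theorem tneg_one_mul_tneg_one_mul (a : T) : tneg (1 : T) * (tneg 1 * a) = a := by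
  rw [← mul_assoc, tneg_one_mul_self, one_mul]

theorem sgn_one : sgn T 1 = 1 := if_pos rfl

theorem sgn_neg_one : sgn T (-1) = tneg 1 := if_neg (by decide)

theorem sgn_mul (s t : ℤˣ) : sgn T (s * t) = sgn T s * sgn T t := by
  rcases Int.units_eq_one_or s with rfl | rfl <;> rcases Int.units_eq_one_or t with rfl | rfl <;>
    simp [sgn_one, sgn_neg_one, tneg_one_mul_self]

theorem NullSum.mul_left {ι : Type*} [Fintype ι] {f : ι → T} (a : T) (h : NullSum f) :
    NullSum fun i => a * f i :=
  toAmbient_mul_mem h a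

theorem nullSum_mul_left_iff {ι : Type*} [Fintype ι] {f : ι → T} {a : T} (ha : a ≠ 0) :
    (NullSum fun i => a * f i) ↔ NullSum f := by
  refine ⟨fun h => ?_, fun h => h.mul_left a⟩
  simpa [← mul_assoc, ha] using h.mul_left a⁻¹

/-- A three-term sum `0 - b + c` is null only if `b = c`. -/
theorem NullSum.eq_of_left_eq_zero {b c : T} (h : NullSum ![0, tneg b, c]) : c = b := by
  have h : toAmbient (tneg b) + toAmbient c ∈ Tract.nullset (T := T) := by
    simpa [NullSum, Fin.sum_univ_three, toAmbient_zero] using h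
  rw [eq_tneg_of_mem h, tneg_tneg]

theorem NullSum.eq_zero_of_single {a : T} (h : NullSum ![a, tneg 0, 0]) : a = 0 := by
  have h : toAmbient (0 : T) + toAmbient a ∈ Tract.nullset (T := T) := by
    simpa [NullSum, Fin.sum_univ_three, toAmbient_zero, tneg_zero] using h
  rw [eq_tneg_of_mem h, tneg_zero]

end TractArithmetic

/-! ### Alternating functions and manipulation of tuples. -/

section Alternating

variable {T : Type u} [Tract T] {E : Type v}

/-- A function on tuples is alternating if a permutation of the arguments multiplies its value by
the sign of the permutation. -/
def IsAlternating {s : ℕ} (φ : (Fin s → E) → T) : Prop :=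
  ∀ (e : Fin s → E) (σ : Equiv.Perm (Fin s)), φ (e ∘ σ) = sgn T (Equiv.Perm.sign σ) * φ e

/-- Adjacent transpositions generate the symmetric group. When lifts are glued, this separates the
swap of the first two entries from the swaps further right. -/
theorem isAlternating_of_adjacent {s : ℕ} {φ : (Fin (s + 1) → E) → T}
    (h : ∀ e (i : Fin s), φ (e ∘ Equiv.swap i.castSucc i.succ) = tneg 1 * φ e) :
    IsAlternating φ := by
  intro e σ
  have hσ : σ ∈ Submonoid.closure (range fun i : Fin s => Equiv.swap i.castSucc i.succ) := by
    rw [Equiv.Perm.mclosure_swap_castSucc_succ]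
    trivial
  induction hσ using Submonoid.closure_induction generalizing e with
  | mem σ hσ =>
    obtain ⟨i, rfl⟩ := hσ
    dsimp only
    rw [h, Equiv.Perm.sign_swap (Fin.castSucc_lt_succ).ne, sgn_neg_one]
  | one => simp [sgn_one]
  | mul σ τ _ _ hσ hτ =>
    rw [Equiv.Perm.coe_mul, ← Function.comp_assoc, hτ, hσ, Equiv.Perm.sign_mul, sgn_mul,
      ← mul_assoc, mul_comm (sgn T _) (sgn T _)]

theorem IsAlternating.swap {s : ℕ} {φ : (Fin s → E) → T} (h : IsAlternating φ) (e : Fin s → E)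
    {i j : Fin s} (hij : i ≠ j) : φ (e ∘ Equiv.swap i j) = tneg 1 * φ e := by
  rw [h, Equiv.Perm.sign_swap hij, sgn_neg_one]

theorem cons_cons_comp_swap {s : ℕ} (a b : E) (t : Fin s → E) :
    (Fin.cons a (Fin.cons b t : Fin (s + 1) → E) : Fin (s + 2) → E) ∘ Equiv.swap 0 1 =
      Fin.cons b (Fin.cons a t : Fin (s + 1) → E) := by
  funext j
  refine Fin.cases ?_ (fun j => ?_) j
  · simp only [Function.comp_apply, Equiv.swap_apply_left, Fin.cons_zero]
    rfl
  · refine Fin.cases ?_ (fun j => ?_) j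
    · have : (Fin.succ 0 : Fin (s + 2)) = 1 := rfl
      simp [this]
    · rw [Function.comp_apply, Equiv.swap_apply_of_ne_of_ne (by simp [Fin.ext_iff])
        (by simp [Fin.ext_iff])]
      simp

theorem IsAlternating.cons_cons {s : ℕ} {φ : (Fin (s + 2) → E) → T} (h : IsAlternating φ)
    (a b : E) (t : Fin s → E) :
    φ (Fin.cons b (Fin.cons a t : Fin (s + 1) → E)) =
      tneg 1 * φ (Fin.cons a (Fin.cons b t : Fin (s + 1) → E)) := by
  rw [← cons_cons_comp_swap, h.swap _ (by simp)]

theorem joinTuple_one {s : ℕ} (a : E) (t : Fin s → E) :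
    joinTuple (Nat.add_comm 1 s) ![a] t = Fin.cons a t := by
  have h := Fin.append_left_eq_cons ![a] t
  rw [joinTuple, h]
  rfl

theorem joinTuple_cons {k s r : ℕ} (h : k + s = r) (a : E) (x : Fin k → E) (y : Fin s → E) :
    joinTuple (show k + 1 + s = r + 1 by omega) (Fin.cons a x) y =
      Fin.cons a (joinTuple h x y) := by
  subst h
  rw [joinTuple, Fin.append_cons]
  rfl

theorem joinTuple_elim {s r : ℕ} (h : 0 + s = r) (x : Fin 0 → E) (y : Fin s → E) :
    joinTuple h x y = y ∘ Fin.cast (by omega) := by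
  subst h
  rw [Subsingleton.elim x Fin.elim0, joinTuple, Fin.elim0_append]
  rfl

end Alternating

/-! ### Closure and corank in a matroid on a finite set. -/

section Corank

variable {E : Type v}

theorem union_range_cons {s : ℕ} (X : Set E) (a : E) (t : Fin s → E) :
    X ∪ range (Fin.cons a t : Fin (s + 1) → E) = insert a X ∪ range t := by
  rw [Fin.range_cons, union_insert, insert_union]

variable {M : Matroid E}

theorem rk_closure (M : Matroid E) (X : Set E) : rk M (M.closure X) = rk M X := by
  rw [rk, M.eRk_closure_eq, rk]

theorem corank_closure (M : Matroid E) (X : Set E) : corank M (M.closure X) = corank M X := by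
  rw [corank, rk_closure, corank]

theorem corank_congr {X Y : Set E} (h : M.closure X = M.closure Y) : corank M X = corank M Y := by
  rw [← corank_closure, h, corank_closure]

theorem corank_empty (M : Matroid E) : corank M ∅ = rank M := by
  simp [corank, rk]

theorem closure_insert_eq_iff (hM : M.E = univ) {X : Set E} {a b : E} (hb : b ∉ M.closure X) :
    M.closure (insert a X) = M.closure (insert b X) ↔ b ∈ M.closure (insert a X) := by
  constructor
  · intro h
    rw [h]
    exact M.mem_closure_of_mem (mem_insert b X) (by simp [hM])
  · intro h
    exact (M.closure_insert_congr ⟨h, hb⟩).symm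

theorem closure_union_congr {X Y : Set E} (h : M.closure X = M.closure Y) (Z : Set E) :
    M.closure (X ∪ Z) = M.closure (Y ∪ Z) := by
  rw [← M.closure_union_closure_left_eq, h, M.closure_union_closure_left_eq]

theorem closure_insert_mono {X : Set E} (a : E) : M.closure X ⊆ M.closure (insert a X) :=
  M.closure_subset_closure (subset_insert a X)

theorem corank_insert_of_mem {X : Set E} {a : E} (h : a ∈ M.closure X) :
    corank M (insert a X) = corank M X :=
  corank_congr (M.closure_insert_eq_of_mem_closure h)

variable [Fintype E]

theorem rk_cast (M : Matroid E) (X : Set E) : (rk M X : ℕ∞) = M.eRk X :=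
  ENat.natCast_toNat (M.eRk_ne_top_iff.mpr (M.isRkFinite_set X))

theorem rank_cast (M : Matroid E) : (rank M : ℕ∞) = M.eRank :=
  ENat.natCast_toNat (M.eRank_ne_top_iff.mpr inferInstance)

theorem corank_anti {X Y : Set E} (h : X ⊆ Y) : corank M Y ≤ corank M X := by
  have : (rk M X : ℕ∞) ≤ rk M Y := by
    rw [rk_cast, rk_cast]
    exact M.eRk_mono h
  have : rk M X ≤ rk M Y := by exact_mod_cast this
  unfold corank
  omega

theorem corank_insert_of_notMem (hM : M.E = univ) {X : Set E} {a : E} (h : a ∉ M.closure X) :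
    corank M (insert a X) + 1 = corank M X := by
  have h1 := M.eRk_insert_eq_add_one (e := a) (X := X) ⟨by simp [hM], h⟩
  rw [← rk_cast, ← rk_cast] at h1
  have h1 : rk M (insert a X) = rk M X + 1 := by exact_mod_cast h1
  have h2 := rk_add_corank M X
  have h3 := rk_add_corank M (insert a X)
  omega

theorem corank_le_corank_insert (hM : M.E = univ) (X : Set E) (a : E) :
    corank M X ≤ corank M (insert a X) + 1 := by
  by_cases h : a ∈ M.closure X
  · rw [corank_insert_of_mem h]
    omega
  · rw [corank_insert_of_notMem hM h]

theorem corank_eq_zero_iff (hM : M.E = univ) {X : Set E} :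
    corank M X = 0 ↔ M.closure X = univ := by
  have h := rk_add_corank M X
  have hX : X ⊆ M.E := by simp [hM]
  rw [← hM, ← Matroid.spanning_iff_closure_eq, Matroid.spanning_iff_eRk_le, ← rk_cast,
    ← rank_cast, Nat.cast_le]
  omega

/-- Each added element lowers the corank by at most one. Typical use: a tuple of length `corank M X`
whose first entry lies in the closure of `X` cannot span together with `X`. -/
theorem corank_le_corank_union_range (hM : M.E = univ) {k : ℕ} (X : Set E) (e : Fin k → E) :
    corank M X ≤ corank M (X ∪ range e) + k := by
  induction k generalizing X with
  | zero => simp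
  | succ k ih =>
    rw [← Fin.cons_self_tail e, union_range_cons]
    have h1 := ih (insert (e 0) X) (Fin.tail e)
    have h2 := corank_le_corank_insert hM X (e 0)
    omega

/-- A set whose corank exceeds that of a larger flat by `k` spans this flat together with `k`
further elements. -/
theorem exists_closure_union_range_eq (hM : M.E = univ) {X H : Set E} (hH : M.IsFlat H)
    (hX : X ⊆ H) {k : ℕ} (hk : corank M X = corank M H + k) :
    ∃ w : Fin k → E, M.closure (X ∪ range w) = H := by
  induction k generalizing X with
  | zero =>
    refine ⟨Fin.elim0, ?_⟩
    have h1 := rk_add_corank M X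
    have h2 := rk_add_corank M H
    have h3 := (M.isRkFinite_set X).closure_eq_closure_of_subset_of_eRk_ge_eRk hX
      (by rw [← rk_cast, ← rk_cast, Nat.cast_le]; omega)
    simpa [hH.closure] using h3
  | succ k ih =>
    have : ¬ H ⊆ M.closure X := fun h => by
      have := corank_anti (M := M) h
      rw [corank_closure] at this
      omega
    obtain ⟨a, haH, haX⟩ := not_subset.mp this
    have := corank_insert_of_notMem hM haX
    obtain ⟨w, hw⟩ := ih (insert_subset haH hX) (by omega)
    exact ⟨Fin.cons a w, by rw [union_range_cons, hw]⟩

theorem exists_notMem_closure (hM : M.E = univ) {X : Set E} (h : corank M X ≠ 0) :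
    ∃ a, a ∉ M.closure X := by
  rw [Ne, corank_eq_zero_iff hM, eq_univ_iff_forall] at h
  exact not_forall.mp h

end Corank

/-! ### Vanishing of the first cohomology of complete multipartite graphs. -/

section Coboundary

/-- A multiplicative `1`-cocycle on a complete multipartite graph, any two of whose vertices have
a common neighbour, is a coboundary. -/
theorem exists_coboundary {α G : Type*} [CommGroup G] (D : α → α → Prop) (l : α → α → G)
    (hsymm : ∀ a b, D a b → D b a) (htrans : ∀ a b c, ¬ D a b → D a c → D b c)
    (hex : ∀ a b, ∃ c, D a c ∧ D b c) (hinv : ∀ a b, D a b → l a b * l b a = 1)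
    (hcoc : ∀ a b c, D a b → D b c → D a c → l a b * l b c = l a c) :
    ∃ c : α → G, ∀ a b, D a b → c b = c a * l a b := by
  rcases isEmpty_or_nonempty α with hα | ⟨⟨o⟩⟩
  · exact ⟨fun _ => 1, fun a => hα.elim a⟩
  -- The potential at `b` is the product of `l` along the path `o`, `g b`, `b`; `key` says that any
  -- other common neighbour gives the same product.
  choose g hog hg using fun b => hex o b
  have key : ∀ b x, D o x → D b x → l o (g b) * l (g b) b = l o x * l x b := by
    intro b x hox hbx
    by_cases hob : D o b
    · rw [hcoc _ _ _ (hog b) (hsymm _ _ (hg b)) hob, hcoc _ _ _ hox (hsymm _ _ hbx) hob]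
    -- Here `o` and `b` lie in the same part, so the triangle relations apply only through their
    -- neighbours: adjacent `y`, `z` are compared in the triangles `o y z` and `y z b`.
    · have step : ∀ y z, D o y → D b y → D o z → D b z → D y z →
          l o y * l y b = l o z * l z b := by
        intro y z hoy hby hoz hbz hyz
        rw [← hcoc _ _ _ hyz (hsymm _ _ hbz) (hsymm _ _ hby), ← mul_assoc,
          hcoc _ _ _ hoy hyz hoz]
      by_cases hgx : D (g b) x
      · exact step _ _ (hog b) (hg b) hox hbx hgx
      -- Now `g b` and `x` share a part and cannot be compared directly; `h` is adjacent to both.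
      · obtain ⟨h, hoh, hgh⟩ := hex o (g b)
        have hbh := htrans _ _ _ hob hoh
        rw [step _ h (hog b) (hg b) hoh hbh hgh,
          step h x hoh hbh hox hbx (hsymm _ _ (htrans _ _ _ hgx hgh))]
  refine ⟨fun b => l o (g b) * l (g b) b, fun a b hab => ?_⟩
  dsimp only
  by_cases hoa : D o a
  · rw [hcoc _ _ _ (hog a) (hsymm _ _ (hg a)) hoa, key b a hoa (hsymm _ _ hab)]
  · have hob : D o b := by
      by_contra hob
      exact hob (htrans a o b (fun h => hoa (hsymm _ _ h)) hab)
    rw [key a b hob hab, hcoc _ _ _ (hog b) (hsymm _ _ (hg b)) hob, mul_assoc,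
      hinv _ _ (hsymm _ _ hab), mul_one]

end Coboundary

/-! ### Lifts of hyperplane functions: uniqueness, gluing, existence. -/

section Lifts

variable {T : Type u} [Tract T] {E : Type v}

/-- `φ : E ^ s → T` is a lift of the family `η` over `X`: it is alternating, its support consists of
the bases of `M / X`, and fixing all arguments of `φ` but the last one yields a multiple of `η_H`,
where `H` is the hyperplane spanned by `X` and the fixed arguments. -/
structure IsLift (M : Matroid E) (η : Set E → E → T) (X : Set E) {s : ℕ}
    (φ : (Fin s → E) → T) : Prop where
  alternating : IsAlternating φ
  ne_zero_iff : ∀ e, φ e ≠ 0 ↔ M.closure (X ∪ range e) = univ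
  eq_mul : ∀ (k : ℕ) (h : k + 1 = s) (i : Fin k → E), corank M (X ∪ range i) = 1 →
    ∃ c : Tˣ, ∀ x, φ (joinTuple h i ![x]) = c * η (M.closure (X ∪ range i)) x

variable {M : Matroid E} {η : Set E → E → T} {X Y : Set E} {s : ℕ} {φ φ' : (Fin s → E) → T}

theorem IsLift.eq_zero (h : IsLift M η X φ) {e : Fin s → E}
    (he : M.closure (X ∪ range e) ≠ univ) : φ e = 0 := by
  by_contra hc
  exact he ((h.ne_zero_iff e).mp hc)

theorem IsLift.congr (hXY : M.closure X = M.closure Y) (h : IsLift M η X φ) :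
    IsLift M η Y φ where
  alternating := h.alternating
  ne_zero_iff e := by rw [h.ne_zero_iff, closure_union_congr hXY]
  eq_mul k hk i hi := by
    have := closure_union_congr hXY (range i)
    rw [← this]
    exact h.eq_mul k hk i (by rwa [corank_congr this])

/-- Fixing arguments corresponds to contracting them, so a lift restricts to lifts over larger sets.
-/
theorem IsLift.joinTuple {k t : ℕ} (hk : k + t = s) (i : Fin k → E) (h : IsLift M η X φ) :
    IsLift M η (X ∪ range i) fun e => φ (joinTuple hk i e) where
  alternating e σ := by
    obtain ⟨τ, hτ, h'⟩ := joinTuple_comp_perm hk i e σ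
    dsimp only
    rw [h', h.alternating, hτ]
  ne_zero_iff e := by rw [h.ne_zero_iff, range_joinTuple, union_assoc]
  eq_mul l hl j hj := by
    have hr : X ∪ range i ∪ range j = X ∪ range (TractMatroid.joinTuple rfl i j) := by
      rw [range_joinTuple, union_assoc]
    rw [hr] at hj ⊢
    obtain ⟨c, hc⟩ := h.eq_mul (k + l) (by omega) _ hj
    exact ⟨c, fun x => by rw [← hc, joinTuple_assoc]; rfl⟩

theorem IsLift.cons {φ : (Fin (s + 1) → E) → T} (h : IsLift M η X φ) (a : E) :
    IsLift M η (insert a X) fun t => φ (Fin.cons a t) := by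
  have := h.joinTuple (Nat.add_comm 1 s) ![a]
  simpa [joinTuple_one] using this

theorem IsLift.exists_ne_zero [Fintype E] (hM : M.E = univ) (hX : corank M X = s)
    (h : IsLift M η X φ) : ∃ e, φ e ≠ 0 := by
  have h0 : corank M univ = 0 := (corank_eq_zero_iff hM).mpr (by rw [← hM]; simp)
  obtain ⟨w, hw⟩ := exists_closure_union_range_eq hM (H := univ)
    (by rw [← hM]; exact M.ground_isFlat) (subset_univ X) (k := s) (by omega)
  exact ⟨w, (h.ne_zero_iff w).mpr hw⟩

/-- By induction the restrictions of the two lifts to first argument `a` differ by a unit `c a`.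
Evaluating at `(a, b, t)` and `(b, a, t)` shows `c a = c b` when `a`, `b` are independent over `X`.
Positive corank starts the induction: there a lift is a multiple of a single η_H. -/
theorem IsLift.unique [Fintype E] (hM : M.E = univ) {s : ℕ} {X : Set E}
    {φ φ' : (Fin (s + 1) → E) → T} (hX : corank M X = s + 1) (h : IsLift M η X φ)
    (h' : IsLift M η X φ') : ∃ c : Tˣ, ∀ e, φ' e = c * φ e := by
  induction s generalizing X with
  | zero =>
    obtain ⟨c, hc⟩ := h.eq_mul 0 rfl Fin.elim0 (by simpa using hX)
    obtain ⟨c', hc'⟩ := h'.eq_mul 0 rfl Fin.elim0 (by simpa using hX)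
    refine ⟨c' * c⁻¹, fun e => ?_⟩
    have he : TractMatroid.joinTuple rfl Fin.elim0 ![e 0] = e := by
      rw [joinTuple_elim]
      funext j
      obtain rfl : j = 0 := Subsingleton.elim (α := Fin 1) _ _
      rfl
    rw [← he, hc, hc']
    simp [mul_assoc]
  | succ s ih =>
    have hc : ∀ a, ∃ c : Tˣ, a ∉ M.closure X → ∀ t, φ' (Fin.cons a t) = c * φ (Fin.cons a t) := by
      intro a
      by_cases ha : a ∈ M.closure X
      · exact ⟨1, fun h => absurd ha h⟩
      · have := corank_insert_of_notMem hM ha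
        obtain ⟨c, hc⟩ := ih (by omega) (h.cons a) (h'.cons a)
        exact ⟨c, fun _ => hc⟩
    choose c hc using hc
    have step : ∀ a b, a ∉ M.closure X → b ∉ M.closure (insert a X) → c a = c b := by
      intro a b ha hb
      have hbX : b ∉ M.closure X := fun h => hb (closure_insert_mono a h)
      have h1 := corank_insert_of_notMem hM ha
      have h2 := corank_insert_of_notMem hM hb
      obtain ⟨t, ht⟩ := ((h.cons a).cons b).exists_ne_zero hM (by omega)
      have e1 := hc a ha (Fin.cons b t)
      have e2 := hc b hbX (Fin.cons a t)
      rw [h.alternating.cons_cons, h'.alternating.cons_cons, e1, mul_left_comm (c b : T)] at e2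
      have e3 := mul_left_cancel₀ tneg_one_ne_zero e2
      exact Units.ext (mul_right_cancel₀ ht e3)
    -- Elements parallel over `X` are compared through some `d` independent of both.
    have hconst : ∀ a b, a ∉ M.closure X → b ∉ M.closure X → c a = c b := by
      intro a b ha hb
      by_cases hab : b ∈ M.closure (insert a X)
      · have h1 := corank_insert_of_notMem hM ha
        obtain ⟨d, hd⟩ := exists_notMem_closure (X := insert a X) hM (by omega)
        rw [step a d ha hd, ← step b d hb]
        rwa [← (closure_insert_eq_iff hM hb).mpr hab]
      · exact step a b ha hab
    obtain ⟨a, ha⟩ := exists_notMem_closure (X := X) hM (by omega)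
    refine ⟨c a, fun e => ?_⟩
    rw [← Fin.cons_self_tail e]
    by_cases he : e 0 ∈ M.closure X
    · rw [(h.cons _).eq_zero, (h'.cons _).eq_zero, mul_zero]
      all_goals
        rw [Ne, ← corank_eq_zero_iff hM]
        have h1 := corank_insert_of_mem he
        have h2 := corank_le_corank_union_range hM (insert (e 0) X) (Fin.tail e)
        omega
    · rw [hc _ he, hconst a _ ha he]

/-- Local lifts `φ_a` over `X ∪ {a}` that agree up to sign on pairs glue to a lift over `X`. -/
theorem isLift_glue [Fintype E] (hM : M.E = univ) {s : ℕ} {X : Set E}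
    (hX : corank M X = s + 2) (φ : E → (Fin (s + 1) → E) → T)
    (hφ : ∀ a, a ∉ M.closure X → IsLift M η (insert a X) (φ a))
    (hcomp : ∀ a b, a ∉ M.closure X → b ∉ M.closure (insert a X) → ∀ t,
      φ b (Fin.cons a t) = tneg 1 * φ a (Fin.cons b t)) :
    ∃ Φ : (Fin (s + 2) → E) → T, IsLift M η X Φ := by
  classical
  -- The first argument selects the local lift. The value 0 is forced when that argument lies in the
  -- closure of `X`, as the tuple then cannot span.
  let Φ : (Fin (s + 2) → E) → T := fun e =>
    if e 0 ∈ M.closure X then 0 else φ (e 0) (Fin.tail e)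
  have hΦ : ∀ a t, a ∉ M.closure X → Φ (Fin.cons a t) = φ a t := fun a t ha => by simp [Φ, ha]
  have hcons : ∀ a (t : Fin (s + 1) → E), a ∈ M.closure X →
      M.closure (X ∪ range (Fin.cons a t : Fin (s + 2) → E)) ≠ univ := by
    intro a t ha
    rw [union_range_cons, Ne, ← corank_eq_zero_iff hM]
    have h1 := corank_insert_of_mem ha
    have h2 := corank_le_corank_union_range hM (insert a X) t
    omega
  have hsupp : ∀ e, Φ e ≠ 0 ↔ M.closure (X ∪ range e) = univ := by
    intro e
    rw [← Fin.cons_self_tail e]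
    by_cases ha : e 0 ∈ M.closure X
    · refine iff_of_false ?_ (hcons _ _ ha)
      simp [Φ, ha]
    · rw [hΦ _ _ ha, (hφ _ ha).ne_zero_iff, union_range_cons]
  refine ⟨Φ, isAlternating_of_adjacent fun e i => ?_, hsupp, ?_⟩
  · by_cases he : M.closure (X ∪ range e) = univ
    · obtain ⟨a, t, rfl⟩ : ∃ a t, e = Fin.cons a t := ⟨_, _, (Fin.cons_self_tail e).symm⟩
      have ha : a ∉ M.closure X := fun ha => hcons _ _ ha he
      -- The swap of the first two entries is the gluing condition `hcomp`; all later swaps act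
      -- inside `φ a`.
      refine Fin.cases ?_ (fun i => ?_) i
      · obtain ⟨b, t, rfl⟩ : ∃ b t', t = Fin.cons b t' := ⟨_, _, (Fin.cons_self_tail t).symm⟩
        have hb : b ∉ M.closure (insert a X) := by
          intro hb
          rw [union_range_cons, union_range_cons, ← corank_eq_zero_iff hM] at he
          have h1 := corank_insert_of_mem hb
          have h2 := corank_le_corank_union_range hM (insert b (insert a X)) t
          have h3 := corank_le_corank_insert hM X a
          omega
        have hbX : b ∉ M.closure X := fun h => hb (closure_insert_mono a h)
        have hsw := cons_cons_comp_swap a b t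
        simp only [Fin.castSucc_zero, Fin.succ_zero_eq_one]
        rw [hsw, hΦ _ _ ha, hΦ _ _ hbX, hcomp a b ha hb]
      · have hsw : (Fin.cons a t : Fin (s + 2) → E) ∘
            Equiv.swap i.succ.castSucc i.succ.succ =
            Fin.cons a (t ∘ Equiv.swap i.castSucc i.succ) := by
          funext j
          refine Fin.cases ?_ (fun j => ?_) j
          · rw [Function.comp_apply, Equiv.swap_apply_of_ne_of_ne (by simp [Fin.ext_iff])
              (by simp [Fin.ext_iff])]
            rfl
          · rw [Function.comp_apply, Fin.cons_succ, ← Fin.succ_castSucc,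
              (Fin.succ_injective _).swap_apply, Fin.cons_succ, Function.comp_apply]
        rw [hsw, hΦ _ _ ha, hΦ _ _ ha,
          (hφ a ha).alternating.swap _ (Fin.castSucc_lt_succ).ne]
    · have h1 : Φ e = 0 := by
        by_contra hc
        exact he ((hsupp e).mp hc)
      have h2 : Φ (e ∘ Equiv.swap i.castSucc i.succ) = 0 := by
        by_contra hc
        have := (hsupp _).mp hc
        rw [(Equiv.surjective _).range_comp] at this
        exact he this
      rw [h1, h2, mul_zero]
  · rintro k hk i hi
    obtain rfl : k = s + 1 := by omega
    obtain ⟨a, t, rfl⟩ : ∃ a t, i = Fin.cons a t := ⟨_, _, (Fin.cons_self_tail i).symm⟩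
    rw [union_range_cons] at hi ⊢
    have ha : a ∉ M.closure X := by
      intro ha
      have h1 := corank_insert_of_mem ha
      have h2 := corank_le_corank_union_range hM (insert a X) t
      omega
    obtain ⟨c, hc⟩ := (hφ a ha).eq_mul s rfl t hi
    refine ⟨c, fun x => ?_⟩
    rw [← hc, joinTuple_cons rfl, hΦ _ _ ha]

theorem IsLift.unit_mul (c : Tˣ) (h : IsLift M η X φ) : IsLift M η X fun e => c * φ e where
  alternating e σ := by simp only [h.alternating e σ, mul_left_comm]
  ne_zero_iff e := by rw [← h.ne_zero_iff]; simp
  eq_mul k hk i hi := by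
    obtain ⟨d, hd⟩ := h.eq_mul k hk i hi
    exact ⟨c * d, fun x => by rw [hd, Units.val_mul, mul_assoc]⟩

/-- A family of hyperplane functions that lifts over all sets of corank `2` lifts over all sets of
higher corank. -/
theorem exists_isLift [Fintype E] (hM : M.E = univ)
    (h2 : ∀ X : Set E, corank M X = 2 → ∃ φ : (Fin 2 → E) → T, IsLift M η X φ)
    {s : ℕ} {X : Set E} (hX : corank M X = s + 2) :
    ∃ φ : (Fin (s + 2) → E) → T, IsLift M η X φ := by
  induction s generalizing X with
  | zero => exact h2 X hX
  | succ s ih =>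
    have hloc : ∀ a, ∃ φ : (Fin (s + 2) → E) → T, a ∉ M.closure X →
        IsLift M η (insert a X) φ := by
      intro a
      by_cases ha : a ∈ M.closure X
      · exact ⟨0, fun h => absurd ha h⟩
      · have := corank_insert_of_notMem hM ha
        obtain ⟨φ, hφ⟩ := ih (X := insert a X) (by omega)
        exact ⟨φ, fun _ => hφ⟩
    choose φ hφ using hloc
    -- Both sides are lifts over `X ∪ {a, b}`, hence proportional. The sign is split off so that `l
    -- = 1` is precisely the gluing condition.
    have hl : ∀ a b, ∃ l : Tˣ, a ∉ M.closure X → b ∉ M.closure (insert a X) →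
        ∀ t, φ a (Fin.cons b t) = tneg 1 * (l * φ b (Fin.cons a t)) := by
      intro a b
      by_cases hab : a ∉ M.closure X ∧ b ∉ M.closure (insert a X)
      · obtain ⟨ha, hb⟩ := hab
        have hbX : b ∉ M.closure X := fun h => hb (closure_insert_mono a h)
        have h1 := corank_insert_of_notMem hM ha
        have h2 := corank_insert_of_notMem hM hb
        have hba := (hφ b hbX).cons a
        rw [insert_comm] at hba
        obtain ⟨c, hc⟩ := hba.unique hM (by omega) ((hφ a ha).cons b)
        refine ⟨Units.mk0 (tneg 1) tneg_one_ne_zero * c, fun _ _ t => ?_⟩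
        rw [hc, Units.val_mul, Units.val_mk0, mul_assoc, tneg_one_mul_tneg_one_mul]
      · exact ⟨1, fun ha hb => absurd ⟨ha, hb⟩ hab⟩
    choose l hl using hl
    let α := {a // a ∉ M.closure X}
    -- Adjacency means being independent over `X`; the parts of this multipartite graph are the
    -- parallel classes of M/X.
    let D : α → α → Prop := fun a b => M.closure (insert a.1 X) ≠ M.closure (insert b.1 X)
    have hD : ∀ a b : α, D a b ↔ b.1 ∉ M.closure (insert a.1 X) := fun a b =>
      (closure_insert_eq_iff hM b.2).not
    have hinv : ∀ a b : α, D a b → l a b * l b a = 1 := by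
      intro a b hab
      have ha := (hD a b).mp hab
      have h1 := corank_insert_of_notMem hM a.2
      have h2 := corank_insert_of_notMem hM ha
      obtain ⟨t, ht⟩ := ((hφ a a.2).cons b).exists_ne_zero hM (by omega)
      have e1 := hl a b a.2 ha t
      rw [hl b a b.2 ((hD b a).mp (Ne.symm hab)) t, mul_left_comm (l a b : T),
        tneg_one_mul_tneg_one_mul, ← mul_assoc] at e1
      have := mul_right_cancel₀ ht ((one_mul _).trans e1)
      exact Units.ext (by simpa using this.symm)
    -- For `a`, `b`, `c` independent over `X`, passing from `φ a` to `φ c` directly or through `φ b`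
    -- relates the same two nonzero values, up to the same sign.
    have htri : ∀ a b c : α, D a b → c.1 ∉ M.closure (insert b.1 (insert a.1 X)) →
        l a b * l b c = l a c := by
      intro a b c hab hc
      have hb := (hD a b).mp hab
      have hca : c.1 ∉ M.closure (insert a.1 X) := fun h => hc (closure_insert_mono _ h)
      have hcb : c.1 ∉ M.closure (insert b.1 X) := fun h => hc
        (M.closure_subset_closure (insert_subset_insert (subset_insert _ _)) h)
      have h1 := corank_insert_of_notMem hM a.2
      have h2 := corank_insert_of_notMem hM hb
      have h3 := corank_insert_of_notMem hM hc
      obtain ⟨t, ht⟩ := (((hφ a a.2).cons b).cons c).exists_ne_zero hM (by omega)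
      have e1 := hl a b a.2 hb (Fin.cons c t)
      rw [(hφ b b.2).alternating.cons_cons c a, hl b c b.2 hcb (Fin.cons a t),
        tneg_one_mul_tneg_one_mul] at e1
      have e2 := (hφ a a.2).alternating.cons_cons b c t
      rw [hl a c a.2 hca (Fin.cons b t), (hφ c c.2).alternating.cons_cons b a] at e2
      have e4 := e1.symm.trans (mul_left_cancel₀ tneg_one_ne_zero e2).symm
      have e3 : φ c (Fin.cons b (Fin.cons a t : Fin (s + 1) → E)) ≠ 0 := by
        intro h0
        rw [h0, mul_zero, mul_zero, mul_zero] at e1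
        exact ht e1
      rw [mul_left_comm (l a c : T)] at e4
      have e5 := mul_left_cancel₀ tneg_one_ne_zero e4
      rw [← mul_assoc] at e5
      exact Units.ext (by simpa using mul_right_cancel₀ e3 e5)
    obtain ⟨c, hc⟩ := exists_coboundary D (fun a b => l a b) (fun a b h => h.symm)
      (fun a b c hab hac hbc => hac ((not_not.mp hab).trans hbc))
      (fun a b => by
        have h1 := corank_le_corank_insert hM X a
        have h2 := corank_le_corank_insert hM (insert a.1 X) b
        obtain ⟨c, hc⟩ := exists_notMem_closure (X := insert b.1 (insert a.1 X)) hM (by omega)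
        have hcX : c ∉ M.closure X := fun h => hc
          (closure_insert_mono _ (closure_insert_mono _ h))
        refine ⟨⟨c, hcX⟩, (hD _ _).mpr fun h => hc (closure_insert_mono _ h),
          (hD _ _).mpr fun h => hc ?_⟩
        exact M.closure_subset_closure (insert_subset_insert (subset_insert _ _)) h)
      hinv
      (fun a b c hab hbc hac => by
        -- If `a`, `b`, `c` are dependent over `X`, some `d` lies outside their span because `X` has
        -- corank at least 3. The cocycle identities for `a b d`, `b c d` and `a c d` give the one
        -- for `a b c` after cancelling `l c d`.
        by_cases hcl : c.1 ∈ M.closure (insert b.1 (insert a.1 X))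
        · have h1 := corank_le_corank_insert hM X a
          have h2 := corank_le_corank_insert hM (insert a.1 X) b
          obtain ⟨d, hd⟩ := exists_notMem_closure (X := insert b.1 (insert a.1 X)) hM (by omega)
          have hdX : d ∉ M.closure X := fun h => hd
            (closure_insert_mono _ (closure_insert_mono _ h))
          have hsub : ∀ x y z : E, z ∈ M.closure (insert x (insert y X)) →
              M.closure (insert z (insert y X)) ⊆ M.closure (insert x (insert y X)) := by
            intro x y z hz
            refine M.closure_subset_closure_of_subset_closure (insert_subset hz ?_)
            exact (subset_insert x _).trans (M.subset_closure _ (by simp [hM]))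
          have t1 := htri a b ⟨d, hdX⟩ hab hd
          have t2 := htri b c ⟨d, hdX⟩ hbc fun h => hd (by
            rw [insert_comm b.1] at hcl ⊢
            exact hsub _ _ _ hcl h)
          have t3 := htri a c ⟨d, hdX⟩ hac fun h => hd (hsub _ _ _ hcl h)
          rw [← t2, ← mul_assoc, ← t3] at t1
          exact mul_right_cancel t1
        · exact htri a b c hab hcl)
    classical
    refine isLift_glue hM hX
      (fun a e => if ha : a ∉ M.closure X then (c ⟨a, ha⟩ : T) * φ a e else 0)
      (fun a ha => ?_) fun a b ha hb t => ?_
    · simpa [ha] using (hφ a ha).unit_mul (c ⟨a, ha⟩)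
    · have hbX : b ∉ M.closure X := fun h => hb (closure_insert_mono a h)
      rw [dif_pos ha, dif_pos hbX, hc ⟨a, ha⟩ ⟨b, hbX⟩ ((hD _ _).mpr hb), hl a b ha hb t,
        Units.val_mul, mul_left_comm (tneg (1 : T)), tneg_one_mul_tneg_one_mul, mul_assoc]

end Lifts

/-! ### Plücker relations, and passing between lifts and Grassmann–Plücker functions. -/

section Pluecker

variable {T : Type u} [Tract T] {E : Type v}

theorem joinTuple_zero {s : ℕ} (h : 0 + s = s) (x : Fin 0 → E) (y : Fin s → E) :
    joinTuple h x y = y := by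
  rw [joinTuple_elim]
  rfl

/-- The `3`-term Plücker relations. -/
def IsPluecker {s : ℕ} (φ : (Fin s → E) → T) : Prop :=
  ∀ (k : ℕ) (h : k + 2 = s) (e : Fin k → E) (a b c d : E),
    NullSum ![φ (joinTuple h e ![a, b]) * φ (joinTuple h e ![c, d]),
      tneg (φ (joinTuple h e ![a, c]) * φ (joinTuple h e ![b, d])),
      φ (joinTuple h e ![a, d]) * φ (joinTuple h e ![b, c])]

theorem IsPluecker.joinTuple {k s t : ℕ} {φ : (Fin s → E) → T} (h : IsPluecker φ)
    (hk : k + t = s) (i : Fin k → E) : IsPluecker fun e => φ (joinTuple hk i e) := by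
  intro l hl e a b c d
  simp only [joinTuple_assoc]
  exact h (k + l) (by omega) (Fin.append i e) a b c d

theorem IsPluecker.cons {s : ℕ} {φ : (Fin (s + 1) → E) → T} (h : IsPluecker φ) (a : E) :
    IsPluecker fun t : Fin s → E => φ (Fin.cons a t) := by
  have := h.joinTuple (Nat.add_comm 1 s) ![a]
  simpa only [joinTuple_one] using this

/-- Plücker relations are homogeneous of degree two, so they survive rescaling of the function. -/
theorem nullSum_pluecker_mul (x : T) {a b c d e f : T}
    (h : NullSum ![a * b, tneg (c * d), e * f]) :
    NullSum ![x * a * (x * b), tneg (x * c * (x * d)), x * e * (x * f)] := by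
  have := h.mul_left (x * x)
  convert this using 1
  funext j
  fin_cases j
  · simp [mul_mul_mul_comm]
  · simp only [Fin.mk_one, Matrix.cons_val_one, Matrix.cons_val_zero]
    rw [tneg_eq_mul, tneg_eq_mul (c * d), mul_mul_mul_comm, mul_left_comm]
  · simp [mul_mul_mul_comm]

/-- `φ` is an alternating function that satisfies the `3`-term Plücker relations and whose support
consists of the bases of `M / X`. -/
structure IsGPOver (M : Matroid E) (X : Set E) {s : ℕ} (φ : (Fin s → E) → T) : Prop where
  alternating : IsAlternating φ
  ne_zero_iff : ∀ e, φ e ≠ 0 ↔ M.closure (X ∪ range e) = univ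
  pluecker : IsPluecker φ

variable {M : Matroid E} {X : Set E}

theorem IsGPOver.cons {s : ℕ} {φ : (Fin (s + 1) → E) → T} (h : IsGPOver M X φ) (a : E) :
    IsGPOver M (insert a X) fun t => φ (Fin.cons a t) where
  alternating e σ := by
    obtain ⟨τ, hτ, h'⟩ := joinTuple_comp_perm (Nat.add_comm 1 s) ![a] e σ
    dsimp only
    rw [← joinTuple_one, ← joinTuple_one, h', h.alternating, hτ]
  ne_zero_iff e := by rw [h.ne_zero_iff, union_range_cons]
  pluecker := h.pluecker.cons a

variable [Fintype E]

/-- If two tuples span the same hyperplane over `X`, then the hyperplane functions that they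
define are proportional. -/
theorem IsGPOver.exists_unit_mul (hM : M.E = univ) {s : ℕ} {X : Set E}
    {φ : (Fin (s + 1) → E) → T} (h : IsGPOver M X φ) (hX : corank M X = s + 1) {i j : Fin s → E}
    (hi : corank M (X ∪ range i) = 1)
    (hij : M.closure (X ∪ range i) = M.closure (X ∪ range j)) :
    ∃ c : Tˣ, ∀ x, φ (joinTuple rfl i ![x]) = c * φ (joinTuple rfl j ![x]) := by
  induction s generalizing X with
  | zero => exact ⟨1, fun x => by rw [Subsingleton.elim i j]; simp⟩
  | succ s ih =>
    have hhead : ∀ {i : Fin (s + 1) → E}, corank M (X ∪ range i) = 1 → i 0 ∉ M.closure X := by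
      intro i hi hc
      rw [← Fin.cons_self_tail i, union_range_cons] at hi
      have h1 := corank_insert_of_mem hc
      have h2 := corank_le_corank_union_range hM (insert (i 0) X) (Fin.tail i)
      omega
    -- Tuples with a common first entry `a` are covered by the induction hypothesis over `insert a
    -- X`.
    have ih' : ∀ (a : E) (i j : Fin s → E),
        corank M (X ∪ range (Fin.cons a i : Fin (s + 1) → E)) = 1 →
        M.closure (X ∪ range (Fin.cons a i : Fin (s + 1) → E)) =
          M.closure (X ∪ range (Fin.cons a j : Fin (s + 1) → E)) →
        ∃ c : Tˣ, ∀ x, φ (TractMatroid.joinTuple rfl (Fin.cons a i : Fin (s + 1) → E) ![x]) =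
          c * φ (TractMatroid.joinTuple rfl (Fin.cons a j : Fin (s + 1) → E) ![x]) := by
      intro a i j hi hij
      have ha : a ∉ M.closure X := by simpa using hhead hi
      have := corank_insert_of_notMem hM ha
      rw [union_range_cons] at hi hij
      rw [union_range_cons] at hij
      obtain ⟨c, hc⟩ := ih (h.cons a) (by omega) hi hij
      exact ⟨c, fun x => by rw [joinTuple_cons rfl, joinTuple_cons rfl, hc]⟩
    have hH : M.IsFlat (M.closure (X ∪ range i)) := M.isFlat_closure _
    have hXH : X ⊆ M.closure (X ∪ range i) :=
      subset_union_left.trans (M.subset_closure _ (by simp [hM]))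
    have hmem : ∀ x, i x ∈ M.closure (X ∪ range i) := fun x =>
      M.mem_closure_of_mem (Or.inr (mem_range_self x)) (by simp [hM])
    have hmem' : ∀ x, j x ∈ M.closure (X ∪ range i) := fun x => by
      rw [hij]
      exact M.mem_closure_of_mem (Or.inr (mem_range_self x)) (by simp [hM])
    have hj : corank M (X ∪ range j) = 1 := by rw [← corank_congr hij, hi]
    have hi0 := hhead hi
    have hj0 := hhead hj
    have hci := corank_insert_of_notMem hM hi0
    have hcj := corank_insert_of_notMem hM hj0
    rcases s with - | s
    -- Two variables: `i 0` and `j 0` lie in one hyperplane, so the first Plücker term vanishes and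
    -- the remaining two express proportionality.
    · have hzero : φ ![i 0, j 0] = 0 := by
        by_contra hc
        have h1 := (h.ne_zero_iff _).mp hc
        rw [← corank_eq_zero_iff hM] at h1
        have h2 : X ∪ range ![i 0, j 0] ⊆ M.closure (X ∪ range i) := by
          rintro z (hz | ⟨k, rfl⟩)
          · exact hXH hz
          · fin_cases k
            · exact hmem 0
            · exact hmem' 0
        have h3 := corank_anti (M := M) h2
        rw [corank_closure] at h3
        omega
      have hpl : ∀ x y, φ ![i 0, y] * φ ![j 0, x] = φ ![i 0, x] * φ ![j 0, y] := by
        intro x y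
        have := h.pluecker 0 rfl Fin.elim0 (i 0) (j 0) x y
        simp only [joinTuple_zero, hzero, zero_mul] at this
        exact this.eq_of_left_eq_zero
      have hj1 : corank M (X ∪ {j 0}) = 1 := by rw [union_singleton]; omega
      obtain ⟨y, hy⟩ := exists_notMem_closure (X := insert (j 0) X) hM (by omega)
      have hne : ∀ k : Fin 1 → E, corank M (insert (k 0) X) = 1 → y ∉ M.closure (insert (k 0) X) →
          φ ![k 0, y] ≠ 0 := by
        intro k hk hy
        rw [h.ne_zero_iff, ← corank_eq_zero_iff hM]
        have h1 := corank_insert_of_notMem hM hy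
        have h2 : X ∪ range ![k 0, y] = insert y (insert (k 0) X) := by
          ext z
          simp [or_comm]
        rw [h2]
        omega
      have hr : ∀ k : Fin 1 → E, X ∪ range k = insert (k 0) X := fun k => by
        rw [range_unique, union_singleton]
        rfl
      rw [hr i, hr j] at hij
      have hyj := hne j (by omega) hy
      have hyi := hne i (by omega) (by rwa [hij])
      refine ⟨Units.mk0 _ (div_ne_zero hyi hyj), fun x => ?_⟩
      have hjt : ∀ (k : Fin 1 → E) (z : E),
          TractMatroid.joinTuple (r := 2) rfl k ![z] = ![k 0, z] := by
        intro k z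
        funext m
        fin_cases m <;> rfl
      simp only [Nat.zero_add] at *
      rw [hjt, hjt, Units.val_mk0, div_mul_eq_mul_div, eq_div_iff hyj, ← hpl]
    -- For first entries `a`, `b` independent over `X`, extend them by a tuple `w` to span the
    -- hyperplane and move along `(a, i')`, `(a, b, w)`, `(b, a, w)`, `(b, j')`: two changes with
    -- fixed first entry and one swap.
    · have step : ∀ i' j' : Fin (s + 2) → E,
          M.closure (X ∪ range i') = M.closure (X ∪ range i) →
          M.closure (X ∪ range j') = M.closure (X ∪ range i) →
          j' 0 ∉ M.closure (insert (i' 0) X) →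
          ∃ c : Tˣ, ∀ x, φ (TractMatroid.joinTuple rfl i' ![x]) =
            c * φ (TractMatroid.joinTuple rfl j' ![x]) := by
        intro i' j' hi' hj' h0
        obtain ⟨a, i', rfl⟩ : ∃ a t, i' = Fin.cons a t := ⟨_, _, (Fin.cons_self_tail i').symm⟩
        obtain ⟨b, j', rfl⟩ : ∃ a t, j' = Fin.cons a t := ⟨_, _, (Fin.cons_self_tail j').symm⟩
        rw [Fin.cons_zero, Fin.cons_zero] at h0
        have hi1 : corank M (X ∪ range (Fin.cons a i' : Fin (s + 2) → E)) = 1 := by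
          rw [corank_congr hi', hi]
        have hj1 : corank M (X ∪ range (Fin.cons b j' : Fin (s + 2) → E)) = 1 := by
          rw [corank_congr hj', hi]
        have ha : a ∉ M.closure X := by simpa using hhead hi1
        have h1 := corank_insert_of_notMem hM ha
        have h2 := corank_insert_of_notMem hM h0
        have haH : a ∈ M.closure (X ∪ range i) := by
          rw [← hi']
          exact M.mem_closure_of_mem (Or.inr ⟨0, rfl⟩) (by simp [hM])
        have hbH : b ∈ M.closure (X ∪ range i) := by
          rw [← hj']
          exact M.mem_closure_of_mem (Or.inr ⟨0, rfl⟩) (by simp [hM])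
        obtain ⟨w, hw⟩ := exists_closure_union_range_eq hM hH
          (insert_subset hbH (insert_subset haH hXH)) (k := s) (by rw [corank_closure]; omega)
        obtain ⟨c, hc⟩ := ih' a i' (Fin.cons b w) hi1
          (by rw [hi', union_range_cons, union_range_cons, hw])
        obtain ⟨d, hd⟩ := ih' b (Fin.cons a w) j'
          (by rw [union_range_cons, union_range_cons, insert_comm, ← corank_closure, hw,
            corank_closure, hi])
          (by rw [hj', union_range_cons, union_range_cons, insert_comm, hw])
        refine ⟨c * (Units.mk0 (tneg 1) tneg_one_ne_zero * d), fun x => ?_⟩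
        rw [hc, joinTuple_cons rfl, joinTuple_cons rfl, h.alternating.cons_cons b a,
          ← joinTuple_cons rfl, ← joinTuple_cons rfl, hd]
        simp [mul_assoc]
      by_cases hab : j 0 ∈ M.closure (insert (i 0) X)
      -- For parallel first entries, choose `d` in the hyperplane but off their common span and move
      -- along `i`, `(d, i 0, w)`, `(d, j 0, w)`, `j`.
      · have hcl := (closure_insert_eq_iff hM hj0).mpr hab
        obtain ⟨d, hdH, hd⟩ : ∃ d, d ∈ M.closure (X ∪ range i) ∧
            d ∉ M.closure (insert (i 0) X) := by
          by_contra! hcon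
          have := corank_anti (M := M) (show M.closure (X ∪ range i) ⊆ _ from hcon)
          rw [corank_closure, corank_closure] at this
          omega
        have h1 := corank_insert_of_notMem hM hd
        obtain ⟨w, hw⟩ := exists_closure_union_range_eq hM hH
          (insert_subset hdH (insert_subset (hmem 0) hXH)) (k := s) (by rw [corank_closure]; omega)
        have hw' : M.closure (insert d (insert (j 0) X) ∪ range w) = M.closure (X ∪ range i) := by
          rw [← hw]
          exact closure_union_congr (M.closure_insert_congr_right hcl).symm _
        rw [insert_comm, ← union_range_cons, ← union_range_cons] at hw hw'
        obtain ⟨c₁, h₁⟩ := step i (Fin.cons d (Fin.cons (i 0) w : Fin (s + 1) → E)) rfl hw hd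
        obtain ⟨c₂, h₂⟩ := ih' d (Fin.cons (i 0) w) (Fin.cons (j 0) w)
          (by rw [corank_congr hw, hi]) (hw.trans hw'.symm)
        obtain ⟨c₃, h₃⟩ := step (Fin.cons d (Fin.cons (j 0) w : Fin (s + 1) → E)) j hw' hij.symm
          (by
            rw [Fin.cons_zero]
            intro hc
            apply hd
            have hdX : d ∉ M.closure X := fun hc => hd (closure_insert_mono _ hc)
            rw [hcl, ← (closure_insert_eq_iff hM hj0).mpr hc]
            exact M.mem_closure_of_mem (mem_insert _ _) (by simp [hM]))
        exact ⟨c₁ * (c₂ * c₃), fun x => by rw [h₁, h₂, h₃]; simp [mul_assoc]⟩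
      · exact step i j rfl hij.symm hab

/-- One spanning tuple per hyperplane suffices, since by `IsGPOver.exists_unit_mul` all others give
proportional functions. -/
theorem IsGPOver.isLift (hM : M.E = univ) {s : ℕ} {φ : (Fin s → E) → T} (h : IsGPOver M X φ)
    (hX : corank M X = s) {η : Set E → E → T}
    (hη : ∀ H, M.IsFlat H → corank M H = 1 → X ⊆ H → ∃ (k : ℕ) (hk : k + 1 = s) (i : Fin k → E)
      (c : Tˣ), M.closure (X ∪ range i) = H ∧ ∀ x, φ (joinTuple hk i ![x]) = c * η H x) :
    IsLift M η X φ where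
  alternating := h.alternating
  ne_zero_iff := h.ne_zero_iff
  eq_mul k hk i hi := by
    subst hk
    obtain ⟨l, hl, j, c, hj, hc⟩ := hη _ (M.isFlat_closure (X ∪ range i))
      (by rw [corank_closure, hi]) (subset_union_left.trans (M.subset_closure _ (by simp [hM])))
    obtain rfl : l = k := by omega
    obtain ⟨d, hd⟩ := h.exists_unit_mul hM hX hi hj.symm
    exact ⟨d * c, fun x => by rw [hd, hc, Units.val_mul, mul_assoc]⟩

/-- A lift satisfies the Plücker relations if this holds for the lifts over sets of corank `2`. -/
theorem IsLift.isPluecker (hM : M.E = univ) {η : Set E → E → T} {s : ℕ} {φ : (Fin s → E) → T}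
    (h : IsLift M η X φ) (hX : corank M X = s)
    (h2 : ∀ Y : Set E, corank M Y = 2 →
      ∃ ψ : (Fin 2 → E) → T, IsLift M η Y ψ ∧ IsPluecker ψ) :
    IsPluecker φ := by
  intro k hk e a b c d
  have hcor := corank_le_corank_union_range hM X e
  -- By `hcor` this corank is at least 2. If it is 2, the restriction is a multiple of `ψ`; if it is
  -- larger, two more elements never span and every term is zero.
  by_cases he : corank M (X ∪ range e) = 2
  · obtain ⟨ψ, hψ, hpl⟩ := h2 _ he
    obtain ⟨x, hx⟩ := hψ.unique hM he (h.joinTuple hk e)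
    simp only [hx]
    have := hpl 0 rfl Fin.elim0 a b c d
    simp only [joinTuple_zero] at this
    exact nullSum_pluecker_mul _ this
  · have hz : ∀ t, φ (TractMatroid.joinTuple hk e t) = 0 := by
      intro t
      refine h.eq_zero ?_
      rw [range_joinTuple, ← union_assoc, Ne, ← corank_eq_zero_iff hM]
      have := corank_le_corank_union_range hM (X ∪ range e) t
      omega
    simp [hz, NullSum, Fin.sum_univ_three, tneg_zero, toAmbient_zero]

theorem isBase_range_iff (hM : M.E = univ) {r : ℕ} (hr : rank M = r) (e : Fin r → E) :
    M.IsBase (range e) ↔ M.closure (range e) = univ := by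
  constructor
  · intro h
    rw [h.closure_eq, hM]
  · intro h
    have hs : M.Spanning (range e) := by
      rw [Matroid.spanning_iff_closure_eq (by simp [hM]), h, hM]
    have hcard : (range e).encard ≤ M.eRank := by
      rw [← rank_cast, hr, ← image_univ]
      exact (encard_image_le _ _).trans (by simp)
    refine ((M.isRkFinite_set _).indep_of_encard_le_eRk ?_).isBase_of_spanning hs
    rwa [hs.eRk_eq]

theorem GPFunction.ne_zero_iff_isBase {r : ℕ} (φ : GPFunction T E r) (e : Fin r → E) :
    φ e ≠ 0 ↔ φ.matroid.IsBase (range e) := by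
  constructor
  · exact fun h => ⟨e, h, rfl⟩
  · rintro ⟨x, hx, hxe⟩
    exact φ.ne_zero_of_range_eq hx hxe.symm

theorem GPFunction.rank_matroid {r : ℕ} (φ : GPFunction T E r) : rank φ.matroid = r := by
  obtain ⟨B, e, he, rfl⟩ := φ.exists_base
  have h := ((φ.ne_zero_iff_isBase e).mp he).encard_eq_eRank
  rw [← rank_cast, ← image_univ, (φ.injective_of_ne_zero he).encard_image] at h
  simpa using h.symm

theorem GPFunction.isGPOver {r : ℕ} (φ : GPFunction T E r) : IsGPOver φ.matroid ∅ φ where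
  alternating := φ.alternating
  ne_zero_iff e := by
    rw [φ.ne_zero_iff_isBase, isBase_range_iff rfl φ.rank_matroid, empty_union]
  pluecker := φ.pluecker

theorem IsGPOver.isGPBase_iff (hM : M.E = univ) {φ : (Fin (rank M) → E) → T}
    (h : IsGPOver M ∅ φ) (B : Set E) : IsGPBase φ B ↔ M.IsBase B := by
  have key : ∀ e, φ e ≠ 0 ↔ M.IsBase (range e) := fun e => by
    rw [h.ne_zero_iff, isBase_range_iff hM rfl, empty_union]
  constructor
  · rintro ⟨e, he, rfl⟩
    exact (key e).mp he
  · intro hB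
    have hcard : Nat.card B = rank M := by
      rw [rank, ← hB.encard_eq_eRank]
      rfl
    let f : Fin (rank M) ≃ B := (Finite.equivFinOfCardEq hcard).symm
    have hf : range (fun j => (f j : E)) = B :=
      (f.surjective.range_comp (Subtype.val : B → E)).trans Subtype.range_coe
    exact ⟨_, (key _).mpr (by rwa [hf]), hf⟩

/-- An alternating function that satisfies the Plücker relations and whose support consists of the
bases of `M`, as a Grassmann-Plücker function. -/
def IsGPOver.toGPFunction (hM : M.E = univ) {φ : (Fin (rank M) → E) → T}
    (h : IsGPOver M ∅ φ) : GPFunction T E (rank M) where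
  toFun := φ
  exists_base := M.exists_isBase.imp fun B hB => (h.isGPBase_iff hM B).mpr hB
  exchange := by
    rw [show IsGPBase φ = M.IsBase from funext fun B => propext (h.isGPBase_iff hM B)]
    exact M.isBase_exchange
  alternating := h.alternating
  eq_zero e he := by
    by_contra hc
    rw [← Ne, h.ne_zero_iff, empty_union, ← isBase_range_iff hM rfl] at hc
    refine he ?_
    have := hc.encard_eq_eRank
    rw [← rank_cast] at this
    have hcard : Nat.card (range e) = rank M := by
      rw [Nat.card_coe_set_eq, ncard, this]
      rfl
    have hbij := rangeFactorization_surjective (f := e) |>.bijective_of_nat_card_le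
      (by rw [hcard, Nat.card_fin])
    exact fun x y hxy => hbij.1 (Subtype.ext hxy)
  pluecker := h.pluecker

theorem IsGPOver.matroid_toGPFunction (hM : M.E = univ) {φ : (Fin (rank M) → E) → T}
    (h : IsGPOver M ∅ φ) : (h.toGPFunction hM).matroid = M :=
  Matroid.ext_isBase hM.symm fun B _ => h.isGPBase_iff hM B

end Pluecker

/-! ### Covectors without duals, and quotients of rank 1. -/

section Covectors

variable {T : Type u} [Tract T] {E : Type v}

theorem exists_perm_of_range_eq {r : ℕ} {x y : Fin r → E} (hx : Function.Injective x)
    (h : range y = range x) : ∃ σ : Equiv.Perm (Fin r), y = x ∘ σ := by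
  have hy : ∀ j, ∃ i, x i = y j := fun j => by
    have : y j ∈ range x := h ▸ mem_range_self j
    exact this
  choose σ hσ using hy
  have hsurj : Function.Surjective σ := fun i => by
    have : x i ∈ range y := h ▸ mem_range_self i
    obtain ⟨j, hj⟩ := this
    exact ⟨j, hx (by rw [hσ, hj])⟩
  exact ⟨Equiv.ofBijective σ (Finite.surjective_iff_bijective.mp hsurj),
    funext fun j => (hσ j).symm⟩

theorem joinTuple_joinTuple {k l m s t r : ℕ} (hk : k + l = m) (ht : l + s = t) (h : m + s = r)
    (x : Fin k → E) (y : Fin l → E) (z : Fin s → E) :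
    joinTuple h (joinTuple hk x y) z =
      joinTuple (show k + t = r by omega) x (joinTuple ht y z) := by
  subst hk
  rw [joinTuple_assoc]
  rfl

theorem GPFunction.apply_self (φ : GPFunction T E 2) (x : E) : φ ![x, x] = 0 :=
  φ.eq_zero _ fun h => absurd (@h 0 1 rfl) (by simp)

theorem GPFunction.apply_swap (φ : GPFunction T E 2) (x y : E) : φ ![y, x] = tneg (φ ![x, y]) := by
  rw [tneg_eq_mul]
  exact IsAlternating.cons_cons φ.alternating x y ![]

variable [Fintype E]

theorem tupleSign_comp (x : Fin (Fintype.card E) → E) (hx : Function.Bijective x)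
    (τ : Equiv.Perm (Fin (Fintype.card E))) (h : Function.Bijective (x ∘ τ)) :
    tupleSign (x ∘ τ) h = tupleSign x hx * Equiv.Perm.sign τ := by
  rw [tupleSign, tupleSign, ← Equiv.Perm.sign_mul]
  exact congrArg _ (Equiv.ext fun _ => rfl)

theorem bijective_joinTuple_iff {a b : ℕ} (h : a + b = Fintype.card E) (x : Fin a → E)
    (y : Fin b → E) : Function.Bijective (joinTuple h x y) ↔
      Function.Injective x ∧ Function.Injective y ∧ ∀ i j, x i ≠ y j := by
  rw [Fintype.bijective_iff_injective_and_card, joinTuple_injective]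
  simp

theorem exists_bijective_joinTuple {a b : ℕ} (h : a + b = Fintype.card E) {x : Fin a → E}
    (hx : Function.Injective x) : ∃ y : Fin b → E, Function.Bijective (joinTuple h x y) := by
  have h1 : Nat.card ↥((range x)ᶜ) = b := by
    have h2 := ncard_add_ncard_compl (range x)
    rw [ncard_range_of_injective hx, Nat.card_fin, Nat.card_eq_fintype_card] at h2
    rw [Nat.card_coe_set_eq]
    omega
  let f := (Finite.equivFinOfCardEq h1).symm
  exact ⟨fun j => f j, (bijective_joinTuple_iff h _ _).mpr
    ⟨hx, Subtype.val_injective.comp f.injective, fun i j hij => (f j).2 ⟨i, hij⟩⟩⟩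

variable {s : ℕ}

/-- The value of the dual function does not depend on the chosen ordering of the complement. -/
theorem GPFunction.dual_eq (φ : GPFunction T E s) (d : Fin (Fintype.card E - s) → E)
    (e : Fin s → E) (h : Function.Bijective (joinTuple (Nat.sub_add_cancel φ.rank_le_card) d e)) :
    φ.dual d = sgn T (tupleSign _ h) * φ e := by
  have hex : ∃ e : Fin s → E,
      Function.Bijective (joinTuple (Nat.sub_add_cancel φ.rank_le_card) d e) := ⟨e, h⟩
  have key : ∀ e' (h' : Function.Bijective
      (joinTuple (Nat.sub_add_cancel φ.rank_le_card) d e')),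
      sgn T (tupleSign _ h') * φ e' = sgn T (tupleSign _ h) * φ e := by
    intro e' h'
    have hr : ∀ {e : Fin s → E}, Function.Bijective
        (joinTuple (Nat.sub_add_cancel φ.rank_le_card) d e) → range e = (range d)ᶜ := by
      intro e h
      have h1 := h.2.range_eq
      have h2 := ((bijective_joinTuple_iff _ _ _).mp h).2.2
      rw [range_joinTuple] at h1
      ext z
      constructor
      · rintro ⟨j, rfl⟩ ⟨i, hi⟩
        exact h2 i j hi
      · intro hz
        have : z ∈ range d ∪ range e := by rw [h1]; trivial
        exact this.resolve_left hz
    obtain ⟨σ, rfl⟩ := exists_perm_of_range_eq ((bijective_joinTuple_iff _ _ _).mp h).2.1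
      ((hr h').trans (hr h).symm)
    obtain ⟨τ, hτ, hj⟩ := joinTuple_comp_perm (Nat.sub_add_cancel φ.rank_le_card) d e σ
    have : tupleSign _ h' = tupleSign _ h * Equiv.Perm.sign σ := by
      have h'' := h'
      rw [hj] at h''
      rw [← hτ, ← tupleSign_comp _ h τ h'']
      congr 1
    rw [this, φ.alternating, ← mul_assoc, ← sgn_mul, mul_assoc, Int.units_mul_self, mul_one]
  unfold GPFunction.dual
  rw [dif_pos hex]
  exact key _ hex.choose_spec

/-- Moving `z j` to the front of `z` costs `(-1) ^ j`. The other sign does not depend on `j`, so it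
factors out of the sum that defines covectors. -/
theorem GPFunction.dual_joinTuple (φ : GPFunction T E s) {k : ℕ}
    (hk : k + 1 = Fintype.card E - s) (h : k + (s + 1) = Fintype.card E) (i : Fin k → E)
    (z : Fin (s + 1) → E) (hz : Function.Bijective (joinTuple h i z)) (j : Fin (s + 1)) :
    φ.dual (joinTuple hk i ![z j]) =
      sgn T (tupleSign _ hz) * (sgn T ((-1) ^ (j : ℕ)) * φ (z ∘ j.succAbove)) := by
  obtain ⟨τ, hτ, hj⟩ := joinTuple_comp_perm h i z j.cycleRange.symm
  have hcons : z ∘ j.cycleRange.symm = Fin.cons (z j) (z ∘ j.succAbove) := by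
    funext m
    refine Fin.cases ?_ (fun m => ?_) m <;> simp
  have heq : joinTuple (Nat.sub_add_cancel φ.rank_le_card) (joinTuple hk i ![z j])
      (z ∘ j.succAbove) = joinTuple h i z ∘ τ := by
    rw [← hj, hcons, ← joinTuple_one, joinTuple_joinTuple _ (Nat.add_comm 1 s)]
  have hb : Function.Bijective (joinTuple h i z ∘ τ) := hz.comp τ.bijective
  have hb' := hb
  rw [← heq] at hb'
  rw [φ.dual_eq _ _ hb', ← mul_assoc, ← sgn_mul]
  have h1 : tupleSign _ hb' = tupleSign _ hb := by congr 1
  rw [h1, tupleSign_comp _ hz, hτ, Equiv.Perm.sign_symm, Fin.sign_cycleRange]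

/-- Covectors in terms of the Grassmann-Plücker function itself. -/
theorem GPFunction.mem_covectors_iff (φ : GPFunction T E s) (Y : E → T) :
    Y ∈ φ.covectors ↔ ∀ z : Fin (s + 1) → E, Function.Injective z →
      NullSum fun j => Y (z j) * (sgn T ((-1) ^ (j : ℕ)) * φ (z ∘ j.succAbove)) := by
  have key : ∀ (k : ℕ) (hk : k + 1 = Fintype.card E - s) (h : k + (s + 1) = Fintype.card E)
      (i : Fin k → E) (z : Fin (s + 1) → E), Function.Bijective (joinTuple h i z) →
      ((NullSum fun e => Y e * φ.dual (joinTuple hk i ![e])) ↔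
        NullSum fun j => Y (z j) * (sgn T ((-1) ^ (j : ℕ)) * φ (z ∘ j.succAbove))) := by
    intro k hk h i z hz
    have hz' := (bijective_joinTuple_iff _ _ _).mp hz
    -- Elements outside `z` are entries of `i`; they repeat an argument of the dual function and
    -- contribute zero.
    have hsum : ∑ j, toAmbient (Y (z j) * φ.dual (joinTuple hk i ![z j])) =
        ∑ e, toAmbient (Y e * φ.dual (joinTuple hk i ![e])) := by
      refine Fintype.sum_of_injective z hz'.2.1 _ _ (fun e he => ?_) fun _ => rfl
      have hei : e ∈ range i := by
        have : e ∈ range i ∪ range z := by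
          rw [← range_joinTuple h, hz.2.range_eq]
          trivial
        exact this.resolve_right he
      obtain ⟨m, rfl⟩ := hei
      rw [φ.dual_eq_zero _ fun hc => ((joinTuple_injective _ _ _).mp hc).2.2 m 0 rfl, mul_zero,
        toAmbient_zero]
    rw [NullSum, ← hsum, ← nullSum_mul_left_iff (sgn_ne_zero (T := T) (tupleSign _ hz)), NullSum]
    simp only [φ.dual_joinTuple hk h i z hz, mul_left_comm]
  constructor
  · intro hY z hz
    have hcard := Fintype.card_le_of_injective z hz
    rw [Fintype.card_fin] at hcard
    obtain ⟨i, hi⟩ := exists_bijective_joinTuple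
      (show s + 1 + (Fintype.card E - (s + 1)) = Fintype.card E by omega) hz
    have hi' := (bijective_joinTuple_iff _ _ _).mp hi
    have hk : Fintype.card E - (s + 1) + 1 = Fintype.card E - s := by omega
    exact (key _ hk (by omega) i z ((bijective_joinTuple_iff _ _ _).mpr
      ⟨hi'.2.1, hi'.1, fun a b hab => hi'.2.2 b a hab.symm⟩)).mp (hY _ hk i)
  · intro hY k hk i
    by_cases hi : Function.Injective i
    · have h : k + (s + 1) = Fintype.card E := by omega
      obtain ⟨z, hz⟩ := exists_bijective_joinTuple h hi
      exact (key k hk h i z hz).mpr (hY z ((bijective_joinTuple_iff _ _ _).mp hz).2.1)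
    · have : ∀ e, φ.dual (joinTuple hk i ![e]) = 0 := fun e =>
        φ.dual_eq_zero _ fun hc => hi ((joinTuple_injective _ _ _).mp hc).1
      simp [NullSum, this, toAmbient_zero]

theorem nullSum_cancel_left (a : T) : NullSum ![a, tneg a, 0] := by
  simpa [NullSum, Fin.sum_univ_three, toAmbient_zero] using toAmbient_add_tneg a

theorem nullSum_cancel_right (a : T) : NullSum ![0, tneg a, a] := by
  simpa [NullSum, Fin.sum_univ_three, toAmbient_zero, add_comm] using toAmbient_add_tneg a

theorem nullSum_cancel_outer (a : T) : NullSum ![a, tneg 0, tneg a] := by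
  simpa [NullSum, Fin.sum_univ_three, toAmbient_zero, tneg_zero] using toAmbient_add_tneg a

/-- The covectors of a matroid of rank `2` are given by three-term relations. -/
theorem GPFunction.mem_covectors_iff_of_rank_two (φ : GPFunction T E 2) (Y : E → T) :
    Y ∈ φ.covectors ↔ ∀ x y z,
      NullSum ![Y x * φ ![y, z], tneg (Y y * φ ![x, z]), Y z * φ ![x, y]] := by
  have key : ∀ z : Fin 3 → E,
      (fun j => Y (z j) * (sgn T ((-1) ^ (j : ℕ)) * φ (z ∘ j.succAbove))) =
      ![Y (z 0) * φ ![z 1, z 2], tneg (Y (z 1) * φ ![z 0, z 2]), Y (z 2) * φ ![z 0, z 1]] := by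
    intro z
    have h0 : z ∘ Fin.succ = ![z 1, z 2] := by
      funext j
      fin_cases j <;> rfl
    have h1 : z ∘ (1 : Fin 3).succAbove = ![z 0, z 2] := by
      funext j
      fin_cases j <;> rfl
    have h2 : z ∘ (2 : Fin 3).succAbove = ![z 0, z 1] := by
      funext j
      fin_cases j <;> rfl
    funext j
    fin_cases j
    · simp [h0, sgn_one]
    · simp [h1, sgn_neg_one, tneg_eq_mul (Y (z 1) * _), mul_left_comm]
    · simp [h2, sgn_one]
  rw [φ.mem_covectors_iff]
  constructor
  · intro h x y z
    by_cases hinj : Function.Injective ![x, y, z]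
    · have := h _ hinj
      rw [key] at this
      exact this
    · by_cases hxy : x = y
      · subst hxy
        rw [φ.apply_self, mul_zero]
        exact nullSum_cancel_left _
      by_cases hyz : y = z
      · subst hyz
        rw [φ.apply_self, mul_zero]
        exact nullSum_cancel_right _
      by_cases hxz : x = z
      · subst hxz
        rw [φ.apply_self, mul_zero, φ.apply_swap y x, tneg_eq_mul (φ _), mul_left_comm,
          ← tneg_eq_mul]
        exact nullSum_cancel_outer _
      · exfalso
        apply hinj
        intro a b hab
        fin_cases a <;> fin_cases b <;> simp_all
  · intro h z _
    rw [key]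
    exact h _ _ _

/-- In rank 1 the covector relations have two terms, which cancel by commutativity. This serves the
case F = H of the quotient condition. -/
theorem GPFunction.self_mem_covectors (φ : GPFunction T E 1) :
    (fun x => φ ![x]) ∈ φ.covectors := by
  rw [φ.mem_covectors_iff]
  intro z _
  have h0 : z ∘ (0 : Fin 2).succAbove = ![z 1] := by
    funext j
    fin_cases j
    rfl
  have h1 : z ∘ (1 : Fin 2).succAbove = ![z 0] := by
    funext j
    fin_cases j
    rfl
  rw [NullSum, Fin.sum_univ_two]
  simp only [h0, h1, Fin.val_zero, Fin.val_one, pow_zero, pow_one, sgn_one, sgn_neg_one, one_mul]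
  rw [mul_left_comm, mul_comm (φ ![z 1]), ← tneg_eq_mul]
  exact toAmbient_add_tneg _

theorem mem_vectors_mul {f : (Fin s → E) → T} {Y : E → T} (c : T) (hY : Y ∈ vectors f) :
    (fun e => c * Y e) ∈ vectors f := by
  intro k hk i
  simpa only [mul_assoc] using (hY k hk i).mul_left c

variable {M : Matroid E}

/-- If the hyperplane functions `η_H` for the hyperplanes over `X` are covectors of a matroid of rank
`2`, then this matroid is a lift of `η` over `X`. -/
theorem GPFunction.isLift_of_mem_covectors (hM : M.E = univ) {η : Set E → E → T} {X : Set E}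
    (hX : corank M X = 2) (ψ : GPFunction T E 2)
    (hη : ∀ H, M.IsFlat H → corank M H = 1 → X ⊆ H →
      IsHyperplaneFunction H (η H) ∧ η H ∈ ψ.covectors) :
    IsLift M η X ψ := by
  have hXc : X ⊆ M.closure X := M.subset_closure _ (by simp [hM])
  have hrel : ∀ a, a ∉ M.closure X → ∀ x y z,
      NullSum ![η (M.closure (insert a X)) x * ψ ![y, z],
        tneg (η (M.closure (insert a X)) y * ψ ![x, z]),
        η (M.closure (insert a X)) z * ψ ![x, y]] := by
    intro a ha
    have := corank_insert_of_notMem hM ha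
    exact (ψ.mem_covectors_iff_of_rank_two _).mp (hη _ (M.isFlat_closure _)
      (by rw [corank_closure]; omega) (hXc.trans (closure_insert_mono a))).2
  have hne : ∀ a, a ∉ M.closure X → ∀ x,
      η (M.closure (insert a X)) x ≠ 0 ↔ x ∉ M.closure (insert a X) := by
    intro a ha x
    have := corank_insert_of_notMem hM ha
    have := (hη _ (M.isFlat_closure _) (by rw [corank_closure]; omega)
      (hXc.trans (closure_insert_mono a))).1
    rw [← Function.mem_support, this, mem_compl_iff]
  have hzero : ∀ a, a ∉ M.closure X → ∀ x, x ∈ M.closure (insert a X) →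
      η (M.closure (insert a X)) x = 0 := fun a ha x hx => by
    by_contra hc
    exact (hne a ha x).mp hc hx
  have hself : ∀ a : E, a ∈ M.closure (insert a X) := fun a =>
    M.mem_closure_of_mem (mem_insert a X) (by simp [hM])
  have hsymm : ∀ a b, a ∉ M.closure X → b ∉ M.closure (insert a X) →
      a ∉ M.closure (insert b X) := by
    intro a b ha hb hab
    have hbX : b ∉ M.closure X := fun h => hb (closure_insert_mono a h)
    exact hb ((closure_insert_eq_iff hM hbX).mp ((closure_insert_eq_iff hM ha).mpr hab).symm)
  -- At an element `x` of the hyperplane the first term of the relation vanishes, leaving `ψ(x, ·)`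
  -- parallel to the hyperplane function.
  have hpar : ∀ a x, a ∉ M.closure X → x ∈ M.closure (insert a X) → ∀ y z,
      η (M.closure (insert a X)) z * ψ ![x, y] = η (M.closure (insert a X)) y * ψ ![x, z] := by
    intro a x ha hx y z
    have := hrel a ha x y z
    rw [hzero a ha x hx, zero_mul] at this
    exact this.eq_of_left_eq_zero
  -- The support of `ψ` is not assumed to come from M/X. Were `ψ(a, ·)` zero, the relation for a
  -- hyperplane avoiding `a`, evaluated at `a` and a base of `ψ`, would have a single nonzero term.
  have hloop : ∀ a, a ∉ M.closure X → ∃ z, ψ ![a, z] ≠ 0 := by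
    intro a ha
    by_contra! hcon
    have h1 := corank_insert_of_notMem hM ha
    obtain ⟨b, hb⟩ := exists_notMem_closure (X := insert a X) hM (by omega)
    have hbX : b ∉ M.closure X := fun h => hb (closure_insert_mono a h)
    obtain ⟨B, e, he, -⟩ := ψ.exists_base
    have he' : e = ![e 0, e 1] := by
      funext j
      fin_cases j <;> rfl
    have h2 := hrel b hbX a (e 0) (e 1)
    rw [hcon, hcon, mul_zero, mul_zero, ← he'] at h2
    exact mul_ne_zero ((hne b hbX a).mpr (hsymm a b ha hb)) he h2.eq_zero_of_single
  -- Such an `x` lies in every hyperplane over `X`. If `ψ(x, ·)` were nonzero, its support would be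
  -- the complement of each of them, but there are at least two.
  have hclosure : ∀ x, x ∈ M.closure X → ∀ y, ψ ![x, y] = 0 := by
    intro x hx y
    by_contra hy
    obtain ⟨a, ha⟩ := exists_notMem_closure (X := X) hM (by omega)
    have h1 := corank_insert_of_notMem hM ha
    obtain ⟨b, hb⟩ := exists_notMem_closure (X := insert a X) hM (by omega)
    have hbX : b ∉ M.closure X := fun h => hb (closure_insert_mono a h)
    have hy' : ∀ c, c ∉ M.closure X → ∀ z, ψ ![x, z] ≠ 0 ↔ z ∉ M.closure (insert c X) := by
      intro c hc z
      have h2 := corank_insert_of_notMem hM hc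
      have h3 := hpar c x hc (closure_insert_mono c hx)
      obtain ⟨d, hd⟩ := exists_notMem_closure (X := insert c X) hM (by omega)
      have hd' := (hne c hc d).mpr hd
      have hyη : η (M.closure (insert c X)) y ≠ 0 := by
        intro h0
        have := h3 y d
        rw [h0, zero_mul] at this
        exact mul_ne_zero hd' hy this
      rw [← hne c hc z]
      have h4 := h3 y z
      constructor
      · intro hz h0
        rw [h0, zero_mul] at h4
        exact mul_ne_zero hyη hz h4.symm
      · intro hz h0
        rw [h0, mul_zero] at h4
        exact mul_ne_zero hz hy h4
    exact (hy' a ha a).mp ((hy' b hbX a).mpr (hsymm a b ha hb)) (hself a)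
  -- Apply `hpar` at `x = a`; by `hloop` the factor is nonzero.
  have hprop : ∀ a, a ∉ M.closure X →
      ∃ c : Tˣ, ∀ x, ψ ![a, x] = c * η (M.closure (insert a X)) x := by
    intro a ha
    have h1 := corank_insert_of_notMem hM ha
    obtain ⟨b, hb⟩ := exists_notMem_closure (X := insert a X) hM (by omega)
    have hb' := (hne a ha b).mpr hb
    have h2 := hpar a a ha (hself a)
    obtain ⟨z, hz⟩ := hloop a ha
    have hψb : ψ ![a, b] ≠ 0 := by
      intro h0
      have := h2 z b
      rw [h0, mul_zero] at this
      exact mul_ne_zero hb' hz this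
    refine ⟨Units.mk0 _ (div_ne_zero hψb hb'), fun x => ?_⟩
    rw [Units.val_mk0, div_mul_eq_mul_div, eq_div_iff hb', mul_comm, h2, mul_comm]
  refine ⟨ψ.alternating, fun e => ?_, fun k hk i hi => ?_⟩
  · have he : e = ![e 0, e 1] := by
      funext j
      fin_cases j <;> rfl
    have hr : X ∪ range e = insert (e 1) (insert (e 0) X) := by
      rw [he]
      ext z
      simp [or_comm]
    rw [hr, ← corank_eq_zero_iff hM]
    by_cases ha : e 0 ∈ M.closure X
    · have h1 := corank_insert_of_mem ha
      have h2 := corank_le_corank_insert hM (insert (e 0) X) (e 1)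
      refine iff_of_false ?_ (by omega)
      rw [not_not, he]
      exact hclosure _ ha _
    · have h1 := corank_insert_of_notMem hM ha
      obtain ⟨c, hc⟩ := hprop _ ha
      rw [he, hc]
      simp only [ne_eq, mul_eq_zero, Units.ne_zero, false_or, Matrix.cons_val_zero,
        Matrix.cons_val_one]
      rw [← ne_eq, hne _ ha]
      by_cases hb : e 1 ∈ M.closure (insert (e 0) X)
      · have h2 := corank_insert_of_mem hb
        exact iff_of_false (not_not.mpr hb) (by omega)
      · have h2 := corank_insert_of_notMem hM hb
        exact iff_of_true hb (by omega)
  · obtain rfl : k = 1 := by omega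
    have hr : X ∪ range i = insert (i 0) X := by
      rw [range_unique, union_singleton]
      rfl
    rw [hr] at hi ⊢
    have ha : i 0 ∉ M.closure X := fun h => by
      have := corank_insert_of_mem h
      omega
    obtain ⟨c, hc⟩ := hprop _ ha
    refine ⟨c, fun x => ?_⟩
    rw [← hc]
    congr 1
    funext m
    fin_cases m <;> rfl

theorem GPFunction.apply_ne_zero_iff_of_rank_one (χ : GPFunction T E 1) (x : E) :
    χ ![x] ≠ 0 ↔ x ∉ χ.matroid.closure ∅ := by
  have hr : corank χ.matroid ∅ = 1 := by rw [corank_empty, χ.rank_matroid]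
  rw [χ.isGPOver.ne_zero_iff, ← corank_eq_zero_iff rfl]
  have hrange : (∅ : Set E) ∪ range ![x] = insert x ∅ := by simp
  rw [hrange]
  by_cases hx : x ∈ χ.matroid.closure ∅
  · have := corank_insert_of_mem hx
    exact iff_of_false (by omega) (not_not.mpr hx)
  · have := corank_insert_of_notMem rfl hx
    exact iff_of_true (by omega) hx

/-- A matroid of rank `1` is a quotient of `[ψ]` if and only if its only hyperplane function is a
covector of `[ψ]`. -/
theorem GPFunction.isQuotient_iff_of_rank_one (χ : GPFunction T E 1) (ψ : GPFunction T E s) :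
    χ.IsQuotient ψ ↔ (fun x => χ ![x]) ∈ ψ.covectors := by
  have hr : corank χ.matroid ∅ = 1 := by rw [corank_empty, χ.rank_matroid]
  constructor
  · rintro ⟨_, η, hrep, ⟨rfl, hcor⟩, hcov⟩
    let H : Hyperplane χ.matroid :=
      ⟨χ.matroid.closure ∅, χ.matroid.isFlat_closure _, by rw [corank_closure, hr]⟩
    have hne : ∀ x, η H x ≠ 0 ↔ x ∉ χ.matroid.closure ∅ := fun x => by
      rw [← Function.mem_support, hrep.hyperplaneFunction H, mem_compl_iff]
    obtain ⟨a, ha⟩ := exists_notMem_closure (M := χ.matroid) (X := ∅) rfl (by omega)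
    have ha' := (hne a).mpr ha
    have ha'' := (χ.apply_ne_zero_iff_of_rank_one a).mpr ha
    have heq : (fun x => χ ![x]) = fun x => (χ ![a] / η H a) * η H x := by
      funext x
      by_cases hx : x ∈ χ.matroid.closure ∅
      · have h1 : χ ![x] = 0 := by
          by_contra hc
          exact (χ.apply_ne_zero_iff_of_rank_one x).mp hc hx
        have h2 : η H x = 0 := by
          by_contra hc
          exact (hne x).mp hc hx
        rw [h1, h2, mul_zero]
      · have := hcor H 0 rfl Fin.elim0 (by rw [range_eq_empty]) x a hx ha
        rw [joinTuple_zero, joinTuple_zero, div_eq_div_iff ha' ha''] at this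
        rw [div_mul_eq_mul_div, eq_div_iff ha', ← this, mul_comm]
    rw [heq]
    exact mem_vectors_mul _ (hcov H)
  · intro h
    -- The closure of ∅ is the only hyperplane, so no modular triple has to be checked.
    have huniq : ∀ H : Hyperplane χ.matroid, H.1 = χ.matroid.closure ∅ := by
      intro H
      obtain ⟨w, hw⟩ := exists_closure_union_range_eq rfl H.2.1 (empty_subset _) (k := 0)
        (by rw [hr, H.2.2])
      rw [← hw, range_eq_empty, empty_union]
    refine ⟨χ.matroid, fun _ x => χ ![x], ⟨fun H => ?_, fun H₁ H₂ _ h12 => ?_⟩, ⟨rfl, ?_⟩,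
      fun _ => h⟩
    · ext x
      rw [Function.mem_support, χ.apply_ne_zero_iff_of_rank_one, huniq H, mem_compl_iff]
    · exact absurd (Subtype.ext ((huniq H₁).trans (huniq H₂).symm)) h12
    · intro H k hk i _ d e _ _
      obtain rfl : k = 0 := by omega
      rw [joinTuple_zero, joinTuple_zero]

end Covectors

/-! ### Representations by quotients of small corank versus T-matroids. -/

section SmallCorank

variable {T : Type u} [Tract T] {E : Type v} {M : Matroid E} {r s : ℕ}

theorem joinTuple_const {k c : ℕ} (hc : c = 1) (h : k + c = r) (h' : k + 1 = r) (i : Fin k → E)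
    (x : E) : joinTuple h i (fun _ => x) = joinTuple h' i ![x] := by
  subst hc
  congr 1
  funext j
  rw [Subsingleton.elim j 0]
  rfl

theorem const_eq_singleton (x : E) : (fun _ : Fin 1 => x) = ![x] := by
  funext j
  rw [Subsingleton.elim j 0]
  rfl

/-- Rank 0 is separate because `IsLift.unique` needs positive corank; here the function has a
single, nonzero value. -/
theorem GPFunction.equiv_of_rank_zero (hr : r = 0) (φ φ' : GPFunction T E r) : φ ≈ φ' := by
  subst hr
  obtain ⟨_, e, he, -⟩ := φ.exists_base
  obtain ⟨_, e', he', -⟩ := φ'.exists_base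
  obtain rfl := Subsingleton.elim e' e
  refine ⟨Units.mk0 _ (div_ne_zero he' he), fun x => ?_⟩
  rw [Subsingleton.elim x e', Units.val_mk0, div_mul_cancel₀ _ he]

/-- The functions `ψ_F (e, …, e)`, which are hyperplane functions if `F` is a hyperplane. -/
noncomputable def diagonalFunction
    (ψ : ∀ F : SmallCorankFlat M, GPFunction T E (corank M F.1)) (F : Set E) (x : E) : T := by
  classical
  exact if h : M.IsFlat F ∧ (corank M F = 1 ∨ corank M F = 2) then ψ ⟨F, h⟩ fun _ => x else 0

theorem diagonalFunction_eq (ψ : ∀ F : SmallCorankFlat M, GPFunction T E (corank M F.1))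
    (F : SmallCorankFlat M) : diagonalFunction ψ F.1 = fun x => ψ F fun _ => x := by
  funext x
  exact dif_pos F.2

variable [Fintype E]

/-- The rank is a variable with an equation, so that the result applies to rank `corank M H`, which
equals 1 only propositionally. -/
theorem GPFunction.isQuotient_iff (hr : r = 1) (χ : GPFunction T E r) (ψ : GPFunction T E s) :
    χ.IsQuotient ψ ↔ (fun x => χ fun _ => x) ∈ ψ.covectors := by
  subst hr
  simp only [const_eq_singleton]
  exact χ.isQuotient_iff_of_rank_one ψ

theorem GPFunction.const_mem_covectors (hr : r = 1) (χ : GPFunction T E r) :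
    (fun x => χ fun _ => x) ∈ χ.covectors := by
  subst hr
  simp only [const_eq_singleton]
  exact χ.self_mem_covectors

/-- The three-term covector relation for `χ(a, ·)` at `x`, `y`, `z` is the Plücker relation at `a`,
`x`, `y`, `z`. -/
theorem GPFunction.joinTuple_mem_covectors (h : 1 + 1 = r) (χ : GPFunction T E r) (a : E) :
    (fun x => χ (joinTuple h ![a] ![x])) ∈ χ.covectors := by
  subst h
  have hj : ∀ x, joinTuple rfl ![a] ![x] = ![a, x] := fun x => by
    funext j
    fin_cases j <;> rfl
  simp only [hj]
  rw [GPFunction.mem_covectors_iff_of_rank_two]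
  intro x y z
  have := χ.pluecker 0 rfl Fin.elim0 a x y z
  simpa only [joinTuple_zero] using this

theorem GPFunction.isLift_of_rank_two (hM : M.E = univ) {η : Set E → E → T} {X : Set E}
    (hX : corank M X = 2) (hr : r = 2) (ψ : GPFunction T E r)
    (hη : ∀ H, M.IsFlat H → corank M H = 1 → X ⊆ H →
      IsHyperplaneFunction H (η H) ∧ η H ∈ ψ.covectors) :
    IsLift M η X ψ := by
  subst hr
  exact ψ.isLift_of_mem_covectors hM hX hη

theorem GPFunction.isLift_of_rank_one (hM : M.E = univ) {η : Set E → E → T} {H : Set E}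
    (hH : M.IsFlat H) (hc : corank M H = 1) (hr : r = 1) (χ : GPFunction T E r)
    (hsupp : IsHyperplaneFunction H (η H)) (hη : η H = fun x => χ fun _ => x) :
    IsLift M η H χ where
  alternating := χ.alternating
  ne_zero_iff e := by
    subst hr
    have he : e = fun _ => e 0 := by
      funext j
      rw [Subsingleton.elim j 0]
    have h1 : χ e = η H (e 0) := by
      rw [hη]
      exact congrArg χ.toFun he
    have hrange : H ∪ range e = insert (e 0) H := by
      rw [range_unique, union_singleton]
      rfl
    rw [h1, ← Function.mem_support, hsupp, mem_compl_iff, hrange, ← corank_eq_zero_iff hM]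
    by_cases h : e 0 ∈ H
    · rw [insert_eq_of_mem h]
      exact iff_of_false (not_not.mpr h) (by omega)
    · rw [← hH.closure] at h
      have := corank_insert_of_notMem hM h
      rw [hH.closure] at h
      exact iff_of_true h (by omega)
  eq_mul k hk i hi := by
    subst hr
    obtain rfl : k = 0 := by omega
    refine ⟨1, fun x => ?_⟩
    rw [joinTuple_zero, range_eq_empty, union_empty, hH.closure, hη]
    simp [const_eq_singleton]

theorem IsLift.exists_unit_mul (hM : M.E = univ) {η : Set E → E → T} {X : Set E}
    {φ φ' : (Fin s → E) → T} (hs : s ≠ 0) (hX : corank M X = s) (h : IsLift M η X φ)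
    (h' : IsLift M η X φ') : ∃ c : Tˣ, ∀ e, φ' e = c * φ e := by
  obtain ⟨s, rfl⟩ := Nat.exists_eq_succ_of_ne_zero hs
  exact h.unique hM hX h'

theorem GPFunction.isLift_fQuotient (φ : GPFunction T E (rank M)) (hφ : φ.matroid = M)
    {η : Set E → E → T} {F : Set E} (hF : M.IsFlat F) (h : IsLift M η ∅ φ) :
    IsLift M η F (φ.fQuotient hφ hF) := by
  refine (h.joinTuple (rk_add_corank M F) (spanningTuple M hF)).congr ?_
  rw [empty_union, closure_spanningTuple, hF.closure]

/-- Only the hyperplane quotients enter: the chosen spanning tuple of each hyperplane is the one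
tuple required by `IsGPOver.isLift`. -/
theorem GPFunction.isLift_of_fQuotient (φ : GPFunction T E (rank M)) (hφ : φ.matroid = M)
    {η : Set E → E → T} (hη : ∀ H (hH : M.IsFlat H), corank M H = 1 →
      ∃ c : Tˣ, ∀ x, φ.fQuotient hφ hH (fun _ => x) = c * η H x) :
    IsLift M η ∅ φ := by
  have hM : M.E = univ := by
    rw [← hφ]
    rfl
  have h : IsGPOver M ∅ φ := by
    have := φ.isGPOver
    rwa [hφ] at this
  refine h.isLift hM (corank_empty M) fun H hH hc _ => ?_
  obtain ⟨c, hcx⟩ := hη H hH hc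
  have hk : rk M H + 1 = rank M := by
    have := rk_add_corank M H
    omega
  refine ⟨_, hk, spanningTuple M hH, c, ?_, fun x => ?_⟩
  · rw [empty_union, closure_spanningTuple]
  · rw [← hcx, ← joinTuple_const hc (rk_add_corank M H)]
    rfl

theorem GPFunction.isHyperplaneFunction_fQuotient (φ : GPFunction T E (rank M))
    (hφ : φ.matroid = M) {H : Set E} (hH : M.IsFlat H) (hc : corank M H = 1) :
    IsHyperplaneFunction H fun x => φ.fQuotient hφ hH fun _ => x := by
  have hM : M.E = univ := by
    rw [← hφ]
    rfl
  have h : IsGPOver M ∅ φ := by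
    have := φ.isGPOver
    rwa [hφ] at this
  have hspan := closure_spanningTuple M hH
  have hcs : corank M (range (spanningTuple M hH)) = 1 := by rw [← corank_closure, hspan, hc]
  ext x
  have hne : Nonempty (Fin (corank M H)) := ⟨⟨0, by omega⟩⟩
  have hrange : ∅ ∪ range (joinTuple (rk_add_corank M H) (spanningTuple M hH) fun _ => x) =
      insert x (range (spanningTuple M hH)) := by
    rw [empty_union, range_joinTuple, range_const, union_singleton]
  rw [Function.mem_support, mem_compl_iff]
  refine (h.ne_zero_iff _).trans ?_
  rw [hrange, ← corank_eq_zero_iff hM]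
  by_cases hx : x ∈ H
  · have := corank_insert_of_mem (hspan.symm ▸ hx)
    exact iff_of_false (by omega) (not_not.mpr hx)
  · have := corank_insert_of_notMem hM (hspan.symm ▸ hx)
    exact iff_of_true (by omega) hx

theorem SmallCorankRep.isLift (hM : M.E = univ) (ψ : SmallCorankRep T M)
    (F : SmallCorankFlat M) : IsLift M (diagonalFunction ψ.ψ) F.1 (ψ.ψ F) := by
  rcases F.2.2 with hc | hc
  · refine GPFunction.isLift_of_rank_one hM F.2.1 hc hc _ ?_ (diagonalFunction_eq _ _)
    rw [diagonalFunction_eq]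
    exact ψ.hyperplaneFunction F hc
  · refine GPFunction.isLift_of_rank_two hM hc hc _ fun H hH hc' hFH => ?_
    rw [diagonalFunction_eq ψ.ψ ⟨H, hH, Or.inl hc'⟩]
    exact ⟨ψ.hyperplaneFunction ⟨H, hH, Or.inl hc'⟩ hc',
      (GPFunction.isQuotient_iff hc' _ _).mp (ψ.isQuotient F ⟨H, hH, Or.inl hc'⟩ hc' hFH)⟩

theorem SmallCorankRep.exists_isLift_isPluecker (hM : M.E = univ) (ψ : SmallCorankRep T M)
    {X : Set E} (hX : corank M X = s) (hs : s = 1 ∨ s = 2) :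
    ∃ φ : (Fin s → E) → T, IsLift M (diagonalFunction ψ.ψ) X φ ∧ IsPluecker φ := by
  subst hX
  rw [← corank_closure] at hs ⊢
  exact ⟨_, (ψ.isLift hM ⟨M.closure X, M.isFlat_closure X, hs⟩).congr (M.closure_closure X),
    (ψ.ψ ⟨M.closure X, M.isFlat_closure X, hs⟩).pluecker⟩

theorem SmallCorankRep.exists_isGPOver (hM : M.E = univ) (ψ : SmallCorankRep T M) :
    ∃ φ : (Fin (rank M) → E) → T, IsLift M (diagonalFunction ψ.ψ) ∅ φ ∧ IsGPOver M ∅ φ := by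
  have h2 : ∀ X : Set E, corank M X = 2 → ∃ φ : (Fin 2 → E) → T,
      IsLift M (diagonalFunction ψ.ψ) X φ ∧ IsPluecker φ := fun X hX =>
    ψ.exists_isLift_isPluecker hM hX (Or.inr rfl)
  have h : ∀ r, corank M ∅ = r →
      ∃ φ : (Fin r → E) → T, IsLift M (diagonalFunction ψ.ψ) ∅ φ := by
    rintro (- | - | r) hr
    -- In rank 0 there are no flats of corank 1 or 2, and any nonzero constant is a lift.
    · refine ⟨fun _ => 1, fun e σ => ?_, fun e => ?_, fun k hk => by omega⟩
      · rw [Subsingleton.elim σ 1, Equiv.Perm.sign_one, sgn_one, one_mul]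
      · rw [range_eq_empty, union_empty, ← corank_eq_zero_iff hM]
        exact iff_of_true one_ne_zero hr
    · obtain ⟨φ, hφ, -⟩ := ψ.exists_isLift_isPluecker hM hr (Or.inl rfl)
      exact ⟨φ, hφ⟩
    · exact exists_isLift hM (fun X hX => (h2 X hX).imp fun _ h => h.1) hr
  obtain ⟨φ, hφ⟩ := h _ (corank_empty M)
  exact ⟨φ, hφ, hφ.alternating, hφ.ne_zero_iff, hφ.isPluecker hM (corank_empty M) h2⟩

theorem SmallCorankRep.existsUnique_tMatroid (hM : M.E = univ) (ψ : SmallCorankRep T M) :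
    ∃! m : TMatroid T E (rank M), ∃ hm : m.matroid = M,
      ∀ F : SmallCorankFlat M, (ψ.ψ F).toTMatroid = m.fQuotient hm F.2.1 := by
  obtain ⟨φ₀, hlift, hGP⟩ := ψ.exists_isGPOver hM
  let φ := hGP.toGPFunction hM
  have hφ : φ.matroid = M := hGP.matroid_toGPFunction hM
  refine ⟨φ.toTMatroid, ⟨hφ, fun F => ?_⟩, ?_⟩
  · rw [TMatroid.fQuotient_mk φ hφ F.2.1]
    refine Quotient.sound ?_
    have hc : corank M F.1 ≠ 0 := by
      rcases F.2.2 with h | h <;> omega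
    exact (ψ.isLift hM F).exists_unit_mul hM hc rfl (φ.isLift_fQuotient hφ F.2.1 hlift)
  · rintro m' ⟨hm', h'⟩
    induction m' using Quotient.inductionOn with
    | h φ' =>
      refine Quotient.sound ?_
      by_cases hr : rank M = 0
      · exact GPFunction.equiv_of_rank_zero hr _ _
      -- Agreement on hyperplanes already makes `φ'` a lift, so uniqueness does not use the data of
      -- corank 2.
      have hlift' : IsLift M (diagonalFunction ψ.ψ) ∅ φ' := by
        refine φ'.isLift_of_fQuotient hm' fun H hH hc => ?_
        have h1 := h' ⟨H, hH, Or.inl hc⟩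
        have h2 := h1.trans (TMatroid.fQuotient_mk φ' hm' hH)
        obtain ⟨c, hcx⟩ := Quotient.exact h2
        exact ⟨c, fun x => by
          rw [hcx, diagonalFunction_eq ψ.ψ ⟨H, hH, Or.inl hc⟩]⟩
      exact hlift'.exists_unit_mul hM hr (corank_empty M) hlift

/-- The `F`-quotients for the flats `F` of corank `1` and `2` form a representation. -/
noncomputable def GPFunction.smallCorankRep (φ : GPFunction T E (rank M)) (hφ : φ.matroid = M) :
    SmallCorankRep T M where
  ψ F := φ.fQuotient hφ F.2.1
  hyperplaneFunction H hc := φ.isHyperplaneFunction_fQuotient hφ H.2.1 hc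
  isQuotient F H hc hFH := by
    have hM : M.E = univ := by
      rw [← hφ]
      rfl
    refine (GPFunction.isQuotient_iff hc _ _).mpr ?_
    -- If F has corank 1, then F = H and the function is a covector of its own class. If F has
    -- corank 2, then φ_H is a multiple of φ_F(w, ·) for some `w` with H spanned by F and `w`, a
    -- covector by the Plücker relations.
    rcases F.2.2 with hF | hF
    · obtain rfl : F = H := by
        obtain ⟨w, hw⟩ := exists_closure_union_range_eq hM H.2.1 hFH (k := 0) (by omega)
        rw [range_eq_empty, union_empty, F.2.1.closure] at hw
        exact Subtype.ext hw
      exact GPFunction.const_mem_covectors hc _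
    · let ψ : ∀ F : SmallCorankFlat M, GPFunction T E (corank M F.1) := fun F =>
        φ.fQuotient hφ F.2.1
      have hlift : IsLift M (diagonalFunction ψ) ∅ φ :=
        φ.isLift_of_fQuotient hφ fun H hH hc =>
          ⟨1, fun x => by rw [diagonalFunction_eq ψ ⟨H, hH, Or.inl hc⟩]; simp [ψ]⟩
      obtain ⟨w, hw⟩ := exists_closure_union_range_eq hM H.2.1 hFH (k := 1) (by omega)
      obtain ⟨c, hcx⟩ := (φ.isLift_fQuotient hφ F.2.1 hlift).eq_mul 1 hF.symm w
        (by rw [← corank_closure, hw, hc])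
      have hw0 : w = ![w 0] := by
        funext j
        rw [Subsingleton.elim j 0]
        rfl
      have heq : (fun x => φ.fQuotient hφ H.2.1 fun _ => x) =
          fun x => (c⁻¹ : Tˣ) * φ.fQuotient hφ F.2.1 (joinTuple hF.symm ![w 0] ![x]) := by
        funext x
        rw [← hw0, hcx, hw, diagonalFunction_eq ψ H, Units.inv_mul_cancel_left]
      rw [heq]
      exact mem_vectors_mul _ (GPFunction.joinTuple_mem_covectors hF.symm _ _)

end SmallCorank

end TractMatroid

open TractMatroid
theorem theoremB {T : Type*} [Tract T] (hT : IsPerfect T) {E : Type*} [Fintype E]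
    (M : Matroid E) (hM : M.E = Set.univ) :
    (∀ ψ : SmallCorankRep T M, ∃! m : TMatroid T E (rank M), ∃ hm : m.matroid = M,
      ∀ F : SmallCorankFlat M, (ψ.ψ F).toTMatroid = m.fQuotient hm F.2.1) ∧
    (∀ (m : TMatroid T E (rank M)) (hm : m.matroid = M),
      ∃ ψ : SmallCorankRep T M,
        (∀ F : SmallCorankFlat M, (ψ.ψ F).toTMatroid = m.fQuotient hm F.2.1) ∧
        ∀ ψ' : SmallCorankRep T M,
          (∀ F : SmallCorankFlat M, (ψ'.ψ F).toTMatroid = m.fQuotient hm F.2.1) →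
          ∃ a : SmallCorankFlat M → Tˣ, ∀ F e, ψ'.ψ F e = a F * ψ.ψ F e) := by
  refine ⟨fun ψ => ψ.existsUnique_tMatroid hM, fun m hm => ?_⟩
  have hout : (Quotient.out m).matroid = M := m.matroid_out.trans hm
  refine ⟨(Quotient.out m).smallCorankRep hout, fun F => rfl, fun ψ' h' => ?_⟩
  -- Uniqueness up to scalars is equality of classes, unpacked flat by flat.
  have h : ∀ F, ∃ a : Tˣ, ∀ e,
      ψ'.ψ F e = a * ((Quotient.out m).smallCorankRep hout).ψ F e := fun F =>
    Quotient.exact (h' F).symm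
  exact ⟨fun F => (h F).choose, fun F => (h F).choose_spec⟩
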